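/- Let $m,n\in\mathbb N$, and let $f_1,\dots,f_m,g_1,\dots,g_m:\mathbb R^n\to\mathbb R$ be continuously differentiable. Suppose that there are constants $\mu_f,L_f,L_g>0$ such that every $\nabla f_i$ is $\mu_f$-strongly monotone and $L_f$-Lipschitz, and every $g_i$ is convex with $L_g$-Lipschitz gradient. Put $f=\sum_i f_i$, $g=\sum_i g_i$ and assume that $\operatorname{argmin} g\neq\emptyset$. Let $R,C\in\mathbb R^{m\times m}$ be nonnegative with positive diagonals, with $R\mathbf 1=\mathbf 1$ and $\mathbf 1^TC=\mathbf 1^T$. For a nonnegative matrix $B$ let $\mathcal G_B$ be the digraph on $\{1,\dots,m\}$ with an edge $(j,i)$ iff $B_{ij}>0$, and assume that some vertex is both the root of a spanning tree of $\mathcal G_R$ and the root of a spanning tree of $\mathcal G_{C^T}$. Let $u,v\ge 0$ be the vectors with $u^TR=u^T$, $u^T\mathbf 1=m$, $Cv=v$, $\mathbf 1^Tv=m$. Let $\gamma_{i,k}\ge 0$ and $\lambda_k$ be such that $\hat\gamma_k:=\max_i\gamma_{i,k}=\hat\gamma_0/(k+1)^a$ and $\lambda_k=\lambda_0/(k+1)^b$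 for all $k\ge 0$, where $\hat\gamma_0,\lambda_0>0$, $0<b<a<1$ and $a+b<1$. Suppose that for some $\theta>0$ we have $\frac1m\sum_i u_i\gamma_{i,k}v_i\ge\theta\hat\gamma_k$ for all $k\ge 0$. Let $x_{i,k},y_{i,k}\in\mathbb R^n$ be generated from arbitrary $x_{i,0}$ and $y_{i,0}=\nabla g_i(x_{i,0})+\lambda_0\nabla f_i(x_{i,0})$ by $$x_{i,k+1}=\sum_{j}R_{ij}(x_{j,k}-\gamma_{j,k}y_{j,k}),$$ $$y_{i,k+1}=\sum_jC_{ij}y_{j,k}+\nabla g_i(x_{i,k+1})+\lambda_{k+1}\nabla f_i(x_{i,k+1})-\nabla g_i(x_{i,k})-\lambda_k\nabla f_i(x_{i,k}).$$ Let $\mathbf x_k,\mathbf y_k\in\mathbb R^{m\times n}$ be the matrices with rows $x_{i,k}$ and $y_{i,k}$, and put $\bar x_k=\frac1m\sum_iu_ix_{i,k}$ and $\bar y_k=\frac1m\sum_iy_{i,k}$ (row vectors). A norm $\|\cdot\|$ on $\mathbb R^m$ induces the norm $\|W\|=\big(\sum_{j=1}^n\|W_{\bullet j}\|^2\big)^{1/2}$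 on $\mathbb R^{m\times n}$. Then the problem of minimizing $f$ over $\operatorname{argmin}g$ has a unique solution $x^*$, and the following hold. (a) $\lim_{k\to\infty}\bar x_k=x^*$. There are norms $\|\cdot\|_R$ and $\|\cdot\|_C$ on $\mathbb R^m$, both bounded below by the Euclidean norm, for which the operator norms of $R-\frac1m\mathbf 1u^T$ and of $C-\frac1mv\mathbf 1^T$, respectively, are smaller than $1$. For these norms, and in fact for any norm on $\mathbb R^m$ in their place, $$\|\mathbf x_{k+1}-\mathbf 1\bar x_{k+1}\|_R=\mathcal O\big(1/k^{1-a-b}\big),\qquad \|\mathbf y_{k+1}-v\bar y_{k+1}\|_C=\mathcal O\big(1/k^{1-a-b}\big)\qquad(k\to\infty).$$ (b) There is $Q_1>0$ such that for all sufficiently large $k$ $$f(\bar x_k)-f(x^*)\le\frac{Q_1(L_g+\lambda_0L_f)}{2}\,\frac1{k^{2-2a-3b}}.$$ (c) There are $Q_2,Q_3>0$ such that for all sufficiently large $k$ $$g(\bar x_k)-g(x^*)\le\frac{Q_2(L_g+\lambda_0L_f)}{2}\,\frac1{k^{2-2a-2b}}+\frac{\lambda_0Q_3}{k^b}.$$ 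-/

import Mathlib

open Filter Topology Asymptotics

noncomputable section

namespace IRPP

/-- The space `ℝⁿ` with its Euclidean norm. -/
abbrev E (n : ℕ) := EuclideanSpace ℝ (Fin n)

/-- `h : ℝⁿ → ℝ` is continuously differentiable and its gradient is `μ`-strongly monotone. -/
def IsStronglyConvex {n : ℕ} (μ : ℝ) (h : E n → ℝ) : Prop :=
  ContDiff ℝ 1 h ∧
    ∀ x y : E n, μ * ‖x - y‖ ^ 2 ≤ inner ℝ (gradient h x - gradient h y) (x - y)

/-- `h : ℝⁿ → ℝ` is continuously differentiable and its gradient is `L`-Lipschitz. -/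
def IsSmooth {n : ℕ} (L : ℝ) (h : E n → ℝ) : Prop :=
  ContDiff ℝ 1 h ∧ ∀ x y : E n, ‖gradient h x - gradient h y‖ ≤ L * ‖x - y‖

/-- The global objective `∑ i, h i`. -/
def total {m n : ℕ} (h : Fin m → E n → ℝ) (z : E n) : ℝ := ∑ i, h i z

/-- The set of global minimizers of `h`. -/
def argminSet {n : ℕ} (h : E n → ℝ) : Set (E n) := {z | ∀ w, h z ≤ h w}

/-- `z` solves the bilevel problem: minimize `F` over the set of minimizers of `G`. -/
def IsBilevelSolution {n : ℕ} (F G : E n → ℝ) (z : E n) : Prop :=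
  z ∈ argminSet G ∧ ∀ w ∈ argminSet G, F z ≤ F w

/-- Assumptions on the objectives. -/
structure ProblemAssumption {m n : ℕ} (f g : Fin m → E n → ℝ) (μf Lf Lg : ℝ) : Prop where
  μf_pos : 0 < μf
  Lf_pos : 0 < Lf
  Lg_pos : 0 < Lg
  f_strong : ∀ i, IsStronglyConvex μf (f i)
  f_smooth : ∀ i, IsSmooth Lf (f i)
  g_convex : ∀ i, ConvexOn ℝ Set.univ (g i)
  g_smooth : ∀ i, IsSmooth Lg (g i)
  argmin_nonempty : (argminSet (total g)).Nonempty

/-- `r` is the root of a (directed) spanning tree of the digraph induced by `B`, in which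
`(j, i)` is an edge iff `0 < B i j`. The tree is given by its parent map: every vertex other than
`r` is joined to its parent by an edge of the digraph, and the chain of parents leads to `r`. -/
def IsSpanningTreeRoot {m : ℕ} (B : Matrix (Fin m) (Fin m) ℝ) (r : Fin m) : Prop :=
  ∃ parent : Fin m → Fin m,
    (∀ i, i ≠ r → 0 < B i (parent i)) ∧ ∀ i, ∃ k : ℕ, parent^[k] i = r

/-- Assumptions on the mixing matrices. -/
structure MixingAssumption {m : ℕ} (R C : Matrix (Fin m) (Fin m) ℝ) : Prop where
  R_nonneg : ∀ i j, 0 ≤ R i j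
  R_diag : ∀ i, 0 < R i i
  R_row : ∀ i, ∑ j, R i j = 1
  C_nonneg : ∀ i j, 0 ≤ C i j
  C_diag : ∀ i, 0 < C i i
  C_col : ∀ j, ∑ i, C i j = 1
  common_root : ∃ r, IsSpanningTreeRoot R r ∧ IsSpanningTreeRoot C.transpose r

/-- `u` is the nonnegative left eigenvector of `R`: `uᵀ R = uᵀ`, `uᵀ 1 = m`. -/
structure IsLeftEigenvector {m : ℕ} (R : Matrix (Fin m) (Fin m) ℝ) (u : Fin m → ℝ) : Prop where
  nonneg : ∀ i, 0 ≤ u i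
  eigen : Matrix.vecMul u R = u
  sum_eq : ∑ i, u i = m

/-- `v` is the nonnegative right eigenvector of `C`: `C v = v`, `1ᵀ v = m`. -/
structure IsRightEigenvector {m : ℕ} (C : Matrix (Fin m) (Fin m) ℝ) (v : Fin m → ℝ) : Prop where
  nonneg : ∀ i, 0 ≤ v i
  eigen : Matrix.mulVec C v = v
  sum_eq : ∑ i, v i = m

/-- The largest step-size `γ̂ₖ = max_j γ_{j,k}`. -/
def maxStep {m : ℕ} (γ : ℕ → Fin m → ℝ) (k : ℕ) : ℝ := ⨆ j, γ k j

/-- `αₖ = (1/m) uᵀ diag(γₖ) v`. -/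
def effStep {m : ℕ} (u v : Fin m → ℝ) (γ : ℕ → Fin m → ℝ) (k : ℕ) : ℝ :=
  (1 / (m : ℝ)) * ∑ i, u i * γ k i * v i

/-- Assumptions on the step-sizes `γ` and on the regularization parameters `lam`. -/
structure UpdateRules {m : ℕ} (u v : Fin m → ℝ) (γ : ℕ → Fin m → ℝ) (lam : ℕ → ℝ)
    (a b θ : ℝ) : Prop where
  γ_nonneg : ∀ k i, 0 ≤ γ k i
  maxStep_pos : 0 < maxStep γ 0
  lam_pos : 0 < lam 0
  maxStep_eq : ∀ k : ℕ, maxStep γ k = maxStep γ 0 / ((k : ℝ) + 1) ^ a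
  lam_eq : ∀ k : ℕ, lam k = lam 0 / ((k : ℝ) + 1) ^ b
  b_pos : 0 < b
  b_lt_a : b < a
  a_lt_one : a < 1
  add_lt_one : a + b < 1
  θ_pos : 0 < θ
  effStep_ge : ∀ k, θ * maxStep γ k ≤ effStep u v γ k

/-- `x`, `y` are the iterates of the iteratively regularized push-pull method, started at an
arbitrary `x 0`; `x k i` and `y k i` belong to agent `i` at iteration `k`. -/
structure IsIterates {m n : ℕ} (f g : Fin m → E n → ℝ) (R C : Matrix (Fin m) (Fin m) ℝ)
    (γ : ℕ → Fin m → ℝ) (lam : ℕ → ℝ) (x y : ℕ → Fin m → E n) : Prop where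
  y_zero : ∀ i, y 0 i = gradient (g i) (x 0 i) + lam 0 • gradient (f i) (x 0 i)
  x_succ : ∀ k i, x (k + 1) i = ∑ j, R i j • (x k j - γ k j • y k j)
  y_succ : ∀ k i, y (k + 1) i = ∑ j, C i j • y k j
    + gradient (g i) (x (k + 1) i) + lam (k + 1) • gradient (f i) (x (k + 1) i)
    - gradient (g i) (x k i) - lam k • gradient (f i) (x k i)

/-- The weighted average `(1/m) wᵀ z` of the rows of `z`; `x̄ₖ` has `w = u`, `ȳₖ` has `w = 1`. -/
def wavg {m n : ℕ} (w : Fin m → ℝ) (z : Fin m → E n) : E n :=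
  (1 / (m : ℝ)) • ∑ i, w i • z i

/-- The norm of an `m × n` matrix (given by its rows) induced by the norm `N` on `ℝᵐ`: the
Euclidean norm of the vector of the `N`-norms of the columns. -/
def inducedNorm {m n : ℕ} (N : Seminorm ℝ (Fin m → ℝ)) (W : Fin m → E n) : ℝ :=
  Real.sqrt (∑ j, N (fun i => W i j) ^ 2)

/-- `N` is a norm on `ℝᵐ` that dominates the Euclidean norm and in which `A` is a contraction,
i.e. the operator norm of `A` with respect to `N` is smaller than one. -/
def IsContractionNorm {m : ℕ} (N : Seminorm ℝ (Fin m → ℝ)) (A : Matrix (Fin m) (Fin m) ℝ) : Prop :=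
  (∀ w : Fin m → ℝ, Real.sqrt (∑ i, w i ^ 2) ≤ N w) ∧
    ∃ σ : ℝ, 0 ≤ σ ∧ σ < 1 ∧ ∀ w : Fin m → ℝ, N (A.mulVec w) ≤ σ * N w

end IRPP

end

/-! Let `z k` be the minimizer of `g + lam k • f` and follow three errors: `e`, the distance of the
`u`-average of `x k` to `z k`; `d`, the consensus error of `x k`; `h`, the deviation of `y k` from
`v` times its mean.

Since `y k` has the same mean as the local gradients (`IsIterates.wavg_y`), the averaged iterate
makes a perturbed gradient step of size `~ k^(-a)` on an objective with strong convexity `~ k^(-b)`.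
It contracts towards `z k` by `1 - c k^(-(a+b))`, with perturbation `k^(-a) (d + h)`
(`IsIterates.eventually_norm_wavg_sub_le`). The target itself drifts by `O(1/k)`, because `lam` has
relative decrement at most `1/(k+1)` (`exists_regularized_path`). Drift divided by contraction gives
the rate `k^(-(1-a-b))`.

The errors `d` and `h` contract by a fixed factor in norms adapted to `R` and `C`: powers of a
stochastic matrix with positive diagonal and a rooted spanning tree converge to a rank-one
projection (`hasSmallPowers_sub_projection`, `HasSmallPowers.exists_adapted_norm`). The coupled
inequalities are solved by `consensus_recursion_rate`, and `IsIterates.exists_rate` collects the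
result.

Finally `z k` tends to the bilevel solution by Tikhonov regularization, which gives (a). Smoothness
at `z k` bounds the regularized gap at the average by a multiple of `e ^ 2`; discarding the gap of
`g` and dividing by `lam k` gives (b), bounding `f` from below gives (c). -/

noncomputable section

namespace IRPP

/-! ### Powers of `k + 1` and rates for coupled recursions. -/

/-- `k ↦ (k + 1) ^ (-p)` -/
def powerDecay (p : ℝ) (k : ℕ) : ℝ := ((k : ℝ) + 1) ^ (-p)

lemma powerDecay_pos (p : ℝ) (k : ℕ) : 0 < powerDecay p k :=
  Real.rpow_pos_of_pos (by positivity) _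

lemma powerDecay_one (k : ℕ) : powerDecay 1 k = 1 / ((k : ℝ) + 1) := by
  rw [powerDecay, Real.rpow_neg_one, one_div]

lemma powerDecay_mul (p q : ℝ) (k : ℕ) :
    powerDecay p k * powerDecay q k = powerDecay (p + q) k := by
  rw [powerDecay, powerDecay, powerDecay, ← Real.rpow_add (by positivity)]
  ring_nf

lemma powerDecay_anti {p q : ℝ} (h : p ≤ q) (k : ℕ) : powerDecay q k ≤ powerDecay p k :=
  Real.rpow_le_rpow_of_exponent_le (by linarith [k.cast_nonneg (α := ℝ)]) (by linarith)

lemma powerDecay_le_one {p : ℝ} (h : 0 ≤ p) (k : ℕ) : powerDecay p k ≤ 1 := by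
  simpa [powerDecay] using powerDecay_anti h k

lemma tendsto_powerDecay {p : ℝ} (hp : 0 < p) : Tendsto (powerDecay p) atTop (𝓝 0) :=
  (tendsto_rpow_neg_atTop hp).comp
    (tendsto_atTop_add_const_right _ _ tendsto_natCast_atTop_atTop)

lemma eventually_mul_powerDecay_le {p : ℝ} (hp : 0 < p) (c : ℝ) {ε : ℝ} (hε : 0 < ε) :
    ∀ᶠ k in atTop, c * powerDecay p k ≤ ε := by
  have h := (tendsto_powerDecay hp).const_mul c
  rw [mul_zero] at h
  exact h.eventually_le_const hε

/-- A power of exponent `p ≤ 1` decays by a relative amount of at most `1 / (k + 1)`. -/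
lemma powerDecay_succ_ge {p : ℝ} (h1 : p ≤ 1) (k : ℕ) :
    (1 - powerDecay 1 k) * powerDecay p k ≤ powerDecay p (k + 1) := by
  have ht : (0 : ℝ) < (k : ℝ) + 1 := by positivity
  set t : ℝ := (k : ℝ) + 1 with htdef
  have hr0 : 0 < t / (t + 1) := by positivity
  have hr1 : t / (t + 1) ≤ 1 := by rw [div_le_one (by positivity)]; linarith
  have h2 : 1 - 1 / t ≤ t / (t + 1) := by
    rw [← sub_nonneg, show t / (t + 1) - (1 - 1 / t) = 1 / (t * (t + 1)) by field_simp; ring]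
    positivity
  have h3 : t / (t + 1) ≤ (t / (t + 1)) ^ p := by
    simpa using Real.rpow_le_rpow_of_exponent_ge hr0 hr1 h1
  have h4 : powerDecay p (k + 1) = (t / (t + 1)) ^ p * powerDecay p k := by
    rw [powerDecay, powerDecay, Real.div_rpow ht.le (by positivity), Real.rpow_neg (by positivity),
      Real.rpow_neg (by positivity)]
    have : ((k + 1 : ℕ) : ℝ) + 1 = t + 1 := by push_cast; rfl
    rw [this, ← htdef]
    have := Real.rpow_pos_of_pos ht p
    field_simp
  rw [h4, powerDecay_one]
  exact mul_le_mul_of_nonneg_right (h2.trans h3) (powerDecay_pos _ _).le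

/-- Rate of a slowly contracting error `e` coupled with a linearly contracting error `s`. -/
lemma coupled_recursion_rate {a b c₁ c₂ c₃ c₄ c₅ σ : ℝ} (hb : 0 < b) (hba : b < a)
    (hab : a + b < 1) (hc₁ : 0 < c₁) (hc₂ : 0 ≤ c₂) (hc₄ : 0 ≤ c₄)
    (hσ0 : 0 ≤ σ) (hσ : σ < 1) {e s : ℕ → ℝ}
    (he : ∀ᶠ k in atTop, e (k + 1) ≤ (1 - c₁ * powerDecay (a + b) k) * e k
      + c₂ * powerDecay a k * s k + c₃ * powerDecay 1 k)
    (hs : ∀ᶠ k in atTop, s (k + 1) ≤ σ * s k + c₄ * powerDecay a k * e k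
      + c₅ * powerDecay 1 k) :
    ∃ B, 0 < B ∧ ∀ᶠ k in atTop,
      e k ≤ B * powerDecay (1 - a - b) k ∧ s k ≤ B * powerDecay (1 - a - b) k := by
  -- The induction carries `s` at the faster rate `B * η * powerDecay (1 - a)`. This is consistent
  -- because its forcing `powerDecay a * e` has order `k ^ (-(1 - b))` and `b < a`.
  obtain ⟨η, hη, hη2⟩ : ∃ η, 0 < η ∧ c₂ * η ≤ c₁ / 4 := by
    refine ⟨c₁ / (4 * (c₂ + 1)), by positivity, ?_⟩
    rw [mul_div_assoc', div_le_div_iff₀ (by positivity) (by positivity)]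
    nlinarith
  -- One third of the contraction slack of `s` for each of its losses: the coupling to `e`, the
  -- drift `c₅`, and the decrease of the target bound from `k` to `k + 1`.
  have hε : 0 < (1 - σ) * η / 3 := by have : 0 < 1 - σ := by linarith
                                      positivity
  obtain ⟨k₀, hk₀⟩ := eventually_atTop.1 <| he.and <| hs.and <|
    (eventually_mul_powerDecay_le (p := a + b) (by linarith) c₁ one_pos).and <|
    (eventually_mul_powerDecay_le (p := 1 - a - b) (by linarith) 1 (half_pos hc₁)).and <|
    (eventually_mul_powerDecay_le (p := a - b) (by linarith) c₄ hε).and <|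
    (eventually_mul_powerDecay_le (p := a) (by linarith) c₅ hε).and
    (eventually_mul_powerDecay_le (p := 1) (by linarith) η hε)
  have p1 := powerDecay_pos (1 - a - b) k₀
  have p2 := powerDecay_pos (1 - a) k₀
  obtain ⟨B, hB1, hBc', hBe', hBs'⟩ := ((eventually_ge_atTop (1 : ℝ)).and <|
    (eventually_ge_atTop (4 * c₃ / c₁)).and <|
    (eventually_ge_atTop (e k₀ / powerDecay (1 - a - b) k₀)).and
    (eventually_ge_atTop (s k₀ / (η * powerDecay (1 - a) k₀)))).exists
  have hBc : c₃ ≤ c₁ * B / 4 := by rw [div_le_iff₀ hc₁] at hBc'; linarith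
  have hBe : e k₀ ≤ B * powerDecay (1 - a - b) k₀ := (div_le_iff₀ p1).1 hBe'
  have hBs : s k₀ ≤ B * η * powerDecay (1 - a) k₀ := by
    rw [div_le_iff₀ (by positivity)] at hBs'; linarith
  have hB0 : 0 < B := by linarith
  -- For `e`, the gain `c₁ * B * powerDecay 1 k` is spent as follows: a quarter on `s`, a quarter on
  -- `c₃`, and half on the decrease of the target bound.
  have key : ∀ k ≥ k₀, e k ≤ B * powerDecay (1 - a - b) k ∧
      s k ≤ B * η * powerDecay (1 - a) k := by
    intro k hk
    induction k, hk using Nat.le_induction with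
    | base => exact ⟨hBe, hBs⟩
    | succ k hk ih =>
      obtain ⟨he, hs, h1, h2, h3, h4, h5⟩ := hk₀ k hk
      obtain ⟨ie, is⟩ := ih
      have q1 := powerDecay_pos (1 - a - b) k
      have q2 := powerDecay_pos (1 - a) k
      have q3 := powerDecay_pos 1 k
      have q4 := powerDecay_pos a k
      have m1 : powerDecay (a + b) k * powerDecay (1 - a - b) k = powerDecay 1 k := by
        rw [powerDecay_mul]; ring_nf
      have m2 : powerDecay a k * powerDecay (1 - a) k = powerDecay 1 k := by
        rw [powerDecay_mul]; ring_nf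
      have m3 : powerDecay a k * powerDecay (1 - a - b) k
          = powerDecay (a - b) k * powerDecay (1 - a) k := by
        rw [powerDecay_mul, powerDecay_mul]; ring_nf
      have s1 := powerDecay_succ_ge (p := 1 - a - b) (by linarith) k
      have s2 := powerDecay_succ_ge (p := 1 - a) (by linarith) k
      constructor
      · have i1 : (1 - c₁ * powerDecay (a + b) k) * e k ≤
            (1 - c₁ * powerDecay (a + b) k) * (B * powerDecay (1 - a - b) k) :=
          mul_le_mul_of_nonneg_left ie (by linarith)
        have i2 : c₂ * powerDecay a k * s k ≤
            c₂ * powerDecay a k * (B * η * powerDecay (1 - a) k) :=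
          mul_le_mul_of_nonneg_left is (by positivity)
        have i3 : (1 - c₁ * powerDecay (a + b) k) * (B * powerDecay (1 - a - b) k)
            = B * powerDecay (1 - a - b) k - c₁ * B * powerDecay 1 k := by
          rw [← m1]; ring
        have i4 : c₂ * powerDecay a k * (B * η * powerDecay (1 - a) k)
            = (c₂ * η) * (B * powerDecay 1 k) := by rw [← m2]; ring
        have i5 : (c₂ * η) * (B * powerDecay 1 k) ≤ c₁ / 4 * (B * powerDecay 1 k) :=
          mul_le_mul_of_nonneg_right hη2 (by positivity)
        have i6 := mul_le_mul_of_nonneg_right hBc q3.le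
        have i7 := mul_le_mul_of_nonneg_left s1 hB0.le
        have i8 : 1 * powerDecay (1 - a - b) k * (B * powerDecay 1 k) ≤
          c₁ / 2 * (B * powerDecay 1 k) := mul_le_mul_of_nonneg_right h2 (by positivity)
        linarith
      · have i1 : σ * s k ≤ σ * (B * η * powerDecay (1 - a) k) :=
          mul_le_mul_of_nonneg_left is hσ0
        have i2 : c₄ * powerDecay a k * e k ≤
            c₄ * powerDecay a k * (B * powerDecay (1 - a - b) k) :=
          mul_le_mul_of_nonneg_left ie (by positivity)
        have i3 : c₄ * powerDecay a k * (B * powerDecay (1 - a - b) k)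
            = (c₄ * powerDecay (a - b) k) * (B * powerDecay (1 - a) k) := by
          linear_combination c₄ * B * m3
        have i4 : (c₄ * powerDecay (a - b) k) * (B * powerDecay (1 - a) k) ≤
          (1 - σ) * η / 3 * (B * powerDecay (1 - a) k) :=
          mul_le_mul_of_nonneg_right h3 (by positivity)
        have i5 : c₅ * powerDecay 1 k ≤ (1 - σ) * η / 3 * (B * powerDecay (1 - a) k) := by
          rw [← m2, ← mul_assoc]
          exact mul_le_mul h4 (by nlinarith) q2.le hε.le
        have i6 : η * powerDecay 1 k * (B * powerDecay (1 - a) k) ≤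
          (1 - σ) * η / 3 * (B * powerDecay (1 - a) k) :=
          mul_le_mul_of_nonneg_right h5 (by positivity)
        have i7 := mul_le_mul_of_nonneg_left s2 (mul_pos hB0 hη).le
        linarith
  refine ⟨B * (1 + η), by positivity, eventually_atTop.2 ⟨k₀, fun k hk => ?_⟩⟩
  obtain ⟨h1, h2⟩ := key k hk
  have q1 := powerDecay_pos (1 - a - b) k
  have q2 := powerDecay_anti (p := 1 - a - b) (q := 1 - a) (by linarith) k
  have : B * η * powerDecay (1 - a) k ≤ B * η * powerDecay (1 - a - b) k :=
    mul_le_mul_of_nonneg_left q2 (by positivity)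
  have : 0 ≤ B * η * powerDecay (1 - a - b) k := by positivity
  have : 0 ≤ B * powerDecay (1 - a - b) k := by positivity
  constructor <;> linarith

/-- Rate of an optimality error `e` coupled with two consensus errors `d` and `h`. -/
lemma consensus_recursion_rate {a b c₁ c σ : ℝ} (hb : 0 < b) (hba : b < a) (hab : a + b < 1)
    (hc₁ : 0 < c₁) (hc : 0 ≤ c) (hσ0 : 0 ≤ σ) (hσ : σ < 1) {e d h : ℕ → ℝ}
    (he0 : ∀ k, 0 ≤ e k) (hd0 : ∀ k, 0 ≤ d k) (hh0 : ∀ k, 0 ≤ h k)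
    (he : ∀ᶠ k in atTop, e (k + 1) ≤ (1 - c₁ * powerDecay (a + b) k) * e k
      + c * powerDecay a k * (d k + h k) + c * powerDecay 1 k)
    (hd : ∀ᶠ k in atTop, d (k + 1) ≤ σ * d k + c * powerDecay a k * (e k + d k + h k))
    (hh : ∀ᶠ k in atTop, h (k + 1) ≤ σ * h k + c * d k
      + c * powerDecay a k * (e k + d k + h k) + c * powerDecay 1 k * (1 + e k + d k)) :
    ∃ B, 0 < B ∧ ∀ᶠ k in atTop, e k ≤ B * powerDecay (1 - a - b) k ∧
      d k ≤ B * powerDecay (1 - a - b) k ∧ h k ≤ B * powerDecay (1 - a - b) k := by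
  have h1σ : 0 < 1 - σ := by linarith
  -- The term `c * d` in the recursion of `h` carries no decaying factor, so `d` and `h` are
  -- combined as `K * d + h` with `K` so large that half the slack of `K * d` absorbs it. The factor
  -- becomes `(1 + σ) / 2`, then `(3 + σ) / 4` after absorbing the terms of order `k ^ (-a)`.
  obtain ⟨K, hK1, hKc⟩ : ∃ K, 1 ≤ K ∧ c ≤ (1 - σ) / 2 * K := by
    refine ⟨2 * c / (1 - σ) + 1, by have : 0 ≤ 2 * c / (1 - σ) := by positivity
                                    linarith, ?_⟩
    rw [mul_add, div_mul_div_comm, show (1 - σ) * (2 * c) = c * (2 * (1 - σ)) by ring,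
      mul_div_assoc, div_self (by positivity)]
    linarith
  obtain ⟨B, hB, hBk⟩ := coupled_recursion_rate (s := fun k => K * d k + h k) (e := e)
    (c₁ := c₁) (c₂ := c) (c₃ := c) (c₄ := (K + 2) * c) (c₅ := c) (σ := (3 + σ) / 4)
    hb hba hab hc₁ hc (by positivity) (by linarith) (by linarith) (by
      filter_upwards [he] with k hk
      have : c * powerDecay a k * (d k + h k) ≤ c * powerDecay a k * (K * d k + h k) :=
        mul_le_mul_of_nonneg_left (by nlinarith [hd0 k])
          (mul_nonneg hc (powerDecay_pos _ _).le)
      linarith) (by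
      filter_upwards [hd, hh, eventually_mul_powerDecay_le (p := a) (by linarith) ((K + 2) * c)
        (ε := (1 - σ) / 4) (by linarith)] with k h1 h2 h3
      have ha1 := powerDecay_anti (p := a) (q := 1) (by linarith) k
      have d0 := hd0 k
      have e0 := he0 k
      have hk0 := hh0 k
      have hs : d k + h k ≤ K * d k + h k := by nlinarith
      have i1 := mul_le_mul_of_nonneg_left h1 (by linarith : 0 ≤ K)
      have i2 : c * d k ≤ (1 - σ) / 2 * K * d k := mul_le_mul_of_nonneg_right hKc d0
      have i3 : c * powerDecay 1 k * (e k + d k) ≤ c * powerDecay a k * (e k + d k + h k) := by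
        refine mul_le_mul (mul_le_mul_of_nonneg_left ha1 hc) (by linarith) (by linarith)
          (mul_nonneg hc (powerDecay_pos _ _).le)
      have i4 : (K + 2) * c * powerDecay a k * (d k + h k) ≤ (1 - σ) / 4 * (K * d k + h k) :=
        mul_le_mul h3 hs (by linarith) (by linarith)
      have i5 : 0 ≤ (1 - σ) / 2 * h k := by positivity
      linarith)
  refine ⟨B, hB, hBk.mono fun k hk => ⟨hk.1, ?_, ?_⟩⟩ <;>
  nlinarith [hk.2, hd0 k, hh0 k]

/-! ### Stochastic matrices: adapted norms and convergence of powers. -/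

section Mixing

open scoped Matrix.Module

variable {ι V : Type*} [Fintype ι] [DecidableEq ι] [NormedAddCommGroup V] [NormedSpace ℝ V]

/-- Some power of `A` has arbitrarily small entries. -/
def HasSmallPowers (A : Matrix ι ι ℝ) : Prop :=
  ∀ ε > 0, ∃ p > 0, ∀ i j, |(A ^ p) i j| ≤ ε

lemma HasSmallPowers.transpose {A : Matrix ι ι ℝ} (hA : HasSmallPowers A) :
    HasSmallPowers A.transpose := by
  intro ε hε
  obtain ⟨p, hp, h⟩ := hA ε hε
  exact ⟨p, hp, fun i j => by rw [← Matrix.transpose_pow]; exact h j i⟩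

lemma norm_matrix_smul_le {B : Matrix ι ι ℝ} {c : ℝ} (hc : 0 ≤ c) (hB : ∀ i j, |B i j| ≤ c)
    (W : ι → V) : ‖B • W‖ ≤ Fintype.card ι * c * ‖W‖ := by
  refine (pi_norm_le_iff_of_nonneg (by positivity)).2 fun i => ?_
  rw [Matrix.Module.smul_apply]
  refine (norm_sum_le _ _).trans ?_
  calc ∑ j, ‖B i j • W j‖ ≤ ∑ _j : ι, c * ‖W‖ := by
        refine Finset.sum_le_sum fun j _ => ?_
        rw [norm_smul]
        exact mul_le_mul (hB i j) (norm_le_pi_norm _ _) (norm_nonneg _) hc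
    _ = _ := by simp [mul_assoc]

lemma exists_norm_matrix_smul_le (B : Matrix ι ι ℝ) :
    ∃ c, 0 ≤ c ∧ ∀ W : ι → V, ‖B • W‖ ≤ c * ‖W‖ := by
  have h0 : 0 ≤ ∑ i, ∑ j, |B i j| := by positivity
  refine ⟨Fintype.card ι * ∑ i, ∑ j, |B i j|, by positivity,
    norm_matrix_smul_le h0 fun i j => ?_⟩
  exact (Finset.single_le_sum (f := fun j => |B i j|) (fun _ _ => abs_nonneg _)
    (Finset.mem_univ j)).trans (Finset.single_le_sum (f := fun i => ∑ j, |B i j|)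
      (fun _ _ => by positivity) (Finset.mem_univ i))

lemma matrix_smul_real_smul (B : Matrix ι ι ℝ) (a : ℝ) (W : ι → V) :
    B • (a • W) = a • (B • W) := by
  ext i
  simp [Finset.smul_sum, smul_comm a]

/-- The adapted norm `∑_{j < p} ρ⁻ʲ ‖Aʲ W‖`. -/
def adaptedNorm (V : Type*) [NormedAddCommGroup V] [NormedSpace ℝ V] (A : Matrix ι ι ℝ)
    (ρ : ℝ) (hρ : 0 ≤ ρ) (p : ℕ) : Seminorm ℝ (ι → V) :=
  Seminorm.of (fun W => ∑ j ∈ Finset.range p, (ρ ^ j)⁻¹ * ‖A ^ j • W‖)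
    (fun W W' => by
      rw [← Finset.sum_add_distrib]
      refine Finset.sum_le_sum fun j _ => ?_
      rw [smul_add, ← mul_add]
      exact mul_le_mul_of_nonneg_left (norm_add_le _ _) (by positivity))
    (fun a W => by
      rw [Finset.mul_sum]
      refine Finset.sum_congr rfl fun j _ => ?_
      rw [matrix_smul_real_smul, norm_smul]
      ring)

/-- With `‖A ^ p‖ ≤ 1 / 2` and `ρ ^ p = 1 / 2`, applying `A` shifts the weighted sum by one index
and pulls out `ρ`. The new last term `ρ⁻ᵖ ‖A ^ p • W‖` is at most `‖W‖`, the first term that was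
lost. General `V` allows matrices acting on stacked vectors. -/
lemma HasSmallPowers.exists_adapted_norm {A : Matrix ι ι ℝ} (hA : HasSmallPowers A)
    (V : Type*) [NormedAddCommGroup V] [NormedSpace ℝ V] :
    ∃ (N : Seminorm ℝ (ι → V)) (σ c : ℝ), 0 ≤ σ ∧ σ < 1 ∧ 0 ≤ c ∧ (∀ W, ‖W‖ ≤ N W) ∧
      (∀ W, N W ≤ c * ‖W‖) ∧ ∀ W, N (A • W) ≤ σ * N W := by
  -- In the sup norm a matrix with entries at most `ε` has operator norm at most `card ι * ε`, here
  -- below `1 / 2`.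
  have hε : (0 : ℝ) < 1 / (2 * (Fintype.card ι + 1)) := by positivity
  obtain ⟨p, hp, hAp⟩ := hA _ hε
  have hhalf : ∀ W : ι → V, ‖A ^ p • W‖ ≤ 1 / 2 * ‖W‖ := fun W => by
    refine (norm_matrix_smul_le hε.le hAp W).trans
      (mul_le_mul_of_nonneg_right ?_ (norm_nonneg _))
    rw [mul_one_div, div_le_div_iff₀ (by positivity) (by positivity)]
    linarith
  set ρ : ℝ := (1 / 2) ^ ((p : ℝ)⁻¹) with hρdef
  have hρ : 0 < ρ := by positivity
  have hρ1 : ρ < 1 := Real.rpow_lt_one (by norm_num) (by norm_num) (by positivity)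
  have hρp : ρ ^ p = 1 / 2 := Real.rpow_inv_natCast_pow (by norm_num) hp.ne'
  choose c hc0 hc using fun j => exists_norm_matrix_smul_le (V := V) (A ^ j)
  refine ⟨adaptedNorm V A ρ hρ.le p, ρ, ∑ j ∈ Finset.range p, (ρ ^ j)⁻¹ * c j, hρ.le, hρ1,
    Finset.sum_nonneg fun j _ => mul_nonneg (by positivity) (hc0 j), fun W => ?_, fun W => ?_,
    fun W => ?_⟩
  · change _ ≤ ∑ j ∈ Finset.range p, (ρ ^ j)⁻¹ * ‖A ^ j • W‖
    have := Finset.single_le_sum (f := fun j => (ρ ^ j)⁻¹ * ‖A ^ j • W‖)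
      (fun _ _ => by positivity) (Finset.mem_range.2 hp)
    simpa using this
  · change ∑ j ∈ Finset.range p, (ρ ^ j)⁻¹ * ‖A ^ j • W‖ ≤ _
    rw [Finset.sum_mul]
    refine Finset.sum_le_sum fun j _ => ?_
    rw [mul_assoc]
    exact mul_le_mul_of_nonneg_left (hc j W) (by positivity)
  · change ∑ j ∈ Finset.range p, (ρ ^ j)⁻¹ * ‖A ^ j • A • W‖ ≤
      ρ * ∑ j ∈ Finset.range p, (ρ ^ j)⁻¹ * ‖A ^ j • W‖
    set F : ℕ → ℝ := fun j => (ρ ^ j)⁻¹ * ‖A ^ j • W‖ with hF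
    have h1 : ∀ j, (ρ ^ j)⁻¹ * ‖A ^ j • A • W‖ = ρ * F (j + 1) := fun j => by
      rw [← mul_smul, ← pow_succ, hF]
      simp only [pow_succ]
      field_simp
    have h2 : F p ≤ F 0 := by
      simp only [hF, hρp, pow_zero, one_smul]
      linarith [hhalf W]
    have h3 := Finset.sum_range_succ F p
    have h4 := Finset.sum_range_succ' F p
    simp_rw [h1]
    rw [← Finset.mul_sum]
    exact mul_le_mul_of_nonneg_left (by linarith) hρ.le

/-- All rows put mass at least `δ` on the same column `r`. This part contributes the same amount `δ
* w r` to all averages, and only the remaining mass `1 - δ` can produce a difference. -/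
lemma oscillation_le {P : Matrix ι ι ℝ} (h0 : ∀ i j, 0 ≤ P i j) (h1 : ∀ i, ∑ j, P i j = 1)
    {r : ι} {δ : ℝ} (hδ : ∀ i, δ ≤ P i r) {w : ι → ℝ} {o : ℝ} (hw : ∀ i j, w i - w j ≤ o)
    (i j : ι) : P.mulVec w i - P.mulVec w j ≤ (1 - δ) * o := by

  have : Nonempty ι := ⟨r⟩
  obtain ⟨a, ha⟩ := Finite.exists_min w
  have up : ∀ i, P.mulVec w i ≤ δ * w r + (1 - δ) * (w a + o) := fun i => by
    have : P.mulVec w i ≤ ∑ l, (P i l * (w a + o) +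
        if l = r then P i l * (w r - (w a + o)) else 0) := by
      refine Finset.sum_le_sum fun l _ => ?_
      split_ifs with h
      · subst h; linarith
      · have := mul_le_mul_of_nonneg_left (show w l ≤ w a + o by linarith [hw l a]) (h0 i l)
        simpa using this
    rw [Finset.sum_add_distrib, ← Finset.sum_mul, h1, Finset.sum_ite_eq' Finset.univ r] at this
    simp only [Finset.mem_univ, if_true] at this
    nlinarith [hδ i, hw r a]
  have dn : ∀ i, δ * w r + (1 - δ) * w a ≤ P.mulVec w i := fun i => by
    have : ∑ l, (P i l * w a + if l = r then P i l * (w r - w a) else 0) ≤ P.mulVec w i := by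
      refine Finset.sum_le_sum fun l _ => ?_
      split_ifs with h
      · subst h; linarith
      · have := mul_le_mul_of_nonneg_left (ha l) (h0 i l)
        simpa using this
    rw [Finset.sum_add_distrib, ← Finset.sum_mul, h1, Finset.sum_ite_eq' Finset.univ r] at this
    simp only [Finset.mem_univ, if_true] at this
    nlinarith [hδ i, ha r]
  linarith [up i, dn j]

lemma rowStochastic_pow {P : Matrix ι ι ℝ} (h0 : ∀ i j, 0 ≤ P i j) (h1 : ∀ i, ∑ j, P i j = 1)
    (k : ℕ) : (∀ i j, 0 ≤ (P ^ k) i j) ∧ ∀ i, ∑ j, (P ^ k) i j = 1 := by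
  have : P ^ k ∈ Matrix.rowStochastic ℝ ι :=
    pow_mem (Matrix.mem_rowStochastic_iff_sum.2 ⟨h0, h1⟩) k
  exact Matrix.mem_rowStochastic_iff_sum.1 this

/-- The parent chain is a path to `r`; the positive diagonal allows waiting, so paths of different
lengths can be padded to a common exponent. -/
lemma exists_pow_column_pos {P : Matrix ι ι ℝ} (h0 : ∀ i j, 0 ≤ P i j)
    (h1 : ∀ i, ∑ j, P i j = 1) (hd : ∀ i, 0 < P i i) {r : ι} {parent : ι → ι}
    (hpar : ∀ i, i ≠ r → 0 < P i (parent i)) (hr : ∀ i, ∃ k : ℕ, parent^[k] i = r) :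
    ∃ p > 0, ∀ i, 0 < (P ^ p) i r := by
  have step : ∀ k i j, 0 < P i j → 0 < (P ^ k) j r → 0 < (P ^ (k + 1)) i r := by
    intro k i j hij hj
    rw [pow_succ', Matrix.mul_apply]
    exact (mul_pos hij hj).trans_le (Finset.single_le_sum (f := fun l => P i l * (P ^ k) l r)
      (fun l _ => mul_nonneg (h0 i l) ((rowStochastic_pow h0 h1 k).1 l r)) (Finset.mem_univ j))
  have mono : ∀ i, Monotone fun k => 0 < (P ^ k) i r := fun i =>
    monotone_nat_of_le_succ fun k h => step k i i (hd i) h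
  have reach : ∀ k i, parent^[k] i = r → 0 < (P ^ k) i r := by
    intro k
    induction k with
    | zero => rintro i rfl; simp
    | succ k ih =>
      intro i hi
      -- Nothing is known about the edge from `r` to `parent r`, so at `r` only the diagonal is
      -- used.
      by_cases h : i = r
      · subst h
        exact mono i (Nat.zero_le _) (by simp)
      · exact step k i _ (hpar i h) (ih _ hi)
  choose k hk using hr
  refine ⟨∑ i, k i + 1, by positivity, fun i => mono i ?_ (reach _ _ (hk i))⟩
  exact (Finset.single_le_sum (fun _ _ => Nat.zero_le _) (Finset.mem_univ i)).trans
    (Nat.le_succ _)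

/-- Powers of a row-stochastic matrix with positive diagonal and a rooted spanning tree converge
to the projection given by its left eigenvector `w`. -/
lemma hasSmallPowers_sub_projection {P : Matrix ι ι ℝ} (h0 : ∀ i j, 0 ≤ P i j)
    (h1 : ∀ i, ∑ j, P i j = 1) (hd : ∀ i, 0 < P i i) {r : ι} {parent : ι → ι}
    (hpar : ∀ i, i ≠ r → 0 < P i (parent i)) (hr : ∀ i, ∃ k : ℕ, parent^[k] i = r)
    {w : ι → ℝ} (hw0 : ∀ i, 0 ≤ w i) (hw : Matrix.vecMul w P = w) (hw1 : ∑ i, w i = 1) :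
    HasSmallPowers (P - Matrix.of fun _ j => w j) := by
  set J : Matrix ι ι ℝ := Matrix.of fun _ j => w j with hJ
  have JP : J * P = J := by
    ext i j
    exact congrFun hw j
  have PJ : ∀ Q : Matrix ι ι ℝ, (∀ i, ∑ j, Q i j = 1) → Q * J = J := fun Q hQ => by
    ext i j
    simp [Matrix.mul_apply, hJ, ← Finset.sum_mul, hQ]
  have JJ : J * J = J := PJ J fun i => by simpa [hJ] using hw1
  have JPk : ∀ k, J * P ^ k = J := fun k => by
    induction k with
    | zero => simp
    | succ k ih => rw [pow_succ, ← mul_assoc, ih, JP]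
  -- The exponent starts at one: for exponent zero the left side is `1`, not `1 - J`.
  have hpow : ∀ k, (P - J) ^ (k + 1) = P ^ (k + 1) - J := fun k => by
    induction k with
    | zero => simp
    | succ k ih =>
      rw [pow_succ, ih, sub_mul, mul_sub, mul_sub, ← pow_succ, JP, JJ,
        PJ _ (rowStochastic_pow h0 h1 _).2]
      abel
  obtain ⟨p, hp, hpos⟩ := exists_pow_column_pos h0 h1 hd hpar hr
  have : Nonempty ι := ⟨r⟩
  obtain ⟨i₀, hi₀⟩ := Finite.exists_min fun i => (P ^ p) i r
  set δ := (P ^ p) i₀ r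
  have hδ : 0 < δ := hpos i₀
  obtain ⟨hp0, hp1⟩ := rowStochastic_pow h0 h1 p
  have hδ1 : δ ≤ 1 := by
    rw [← hp1 i₀]
    exact Finset.single_le_sum (fun j _ => hp0 i₀ j) (Finset.mem_univ r)
  -- Doeblin's argument: each block of `p` steps shrinks the oscillation of every column by `1 - δ`.
  have osc : ∀ q i l j, (P ^ (p * q)) i j - (P ^ (p * q)) l j ≤ (1 - δ) ^ q := by
    intro q
    induction q with
    | zero =>
      intro i l j
      simp only [mul_zero, pow_zero, Matrix.one_apply]
      split_ifs <;> norm_num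
    | succ q ih =>
      intro i l j
      have := oscillation_le hp0 hp1 hi₀ (w := fun i => (P ^ (p * q)) i j) (fun i l => ih i l j) i l
      rw [mul_add, mul_one, add_comm, pow_add, pow_succ']
      exact this
  intro ε hε
  obtain ⟨q, hq⟩ := exists_pow_lt_of_lt_one hε (show 1 - δ < 1 by linarith)
  have hq' : (1 - δ) ^ (q + 1) ≤ ε :=
    (pow_le_pow_of_le_one (by linarith) (by linarith) (Nat.le_succ q)).trans hq.le
  have hpq : 0 < p * (q + 1) := by positivity
  refine ⟨p * (q + 1), hpq, fun i j => ?_⟩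
  -- Since `J * P ^ k = J`, an entry of `P ^ k - J` is the `w`-average of differences within one
  -- column, hence at most the oscillation.
  have hval : ((P - J) ^ (p * (q + 1))) i j
      = ∑ l, w l * ((P ^ (p * (q + 1))) i j - (P ^ (p * (q + 1))) l j) := by
    obtain ⟨k, hk⟩ := Nat.exists_eq_succ_of_ne_zero hpq.ne'
    have hJk : J i j = ∑ l, w l * (P ^ (p * (q + 1))) l j := by
      conv_lhs => rw [← JPk (p * (q + 1))]
      rfl
    rw [hk, Nat.succ_eq_add_one, hpow, ← Nat.succ_eq_add_one, ← hk, Matrix.sub_apply, hJk]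
    simp only [mul_sub, Finset.sum_sub_distrib, ← Finset.sum_mul, hw1, one_mul]
  rw [hval]
  refine (Finset.abs_sum_le_sum_abs _ _).trans ?_
  calc _ ≤ ∑ l, w l * ε := by
        refine Finset.sum_le_sum fun l _ => ?_
        rw [abs_mul, abs_of_nonneg (hw0 l)]
        refine mul_le_mul_of_nonneg_left (abs_le.2 ⟨?_, (osc _ _ _ _).trans hq'⟩) (hw0 l)
        linarith [osc (q + 1) l i j]
    _ = ε := by rw [← Finset.sum_mul, hw1, one_mul]

end Mixing

/-! ### Contraction norms for `R` and `C`. -/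

section MixingAssumption

variable {m n : ℕ} {R C : Matrix (Fin m) (Fin m) ℝ} {u v : Fin m → ℝ}

lemma MixingAssumption.pos (h : MixingAssumption R C) : 0 < m := by
  obtain ⟨r, -⟩ := h.common_root
  exact r.pos

lemma MixingAssumption.hasSmallPowers_R (h : MixingAssumption R C) (hu : IsLeftEigenvector R u) :
    HasSmallPowers (Matrix.of fun i j => R i j - u j / (m : ℝ)) := by
  obtain ⟨r, ⟨parent, hpar, hr⟩, -⟩ := h.common_root
  have hm : (m : ℝ) ≠ 0 := by exact_mod_cast h.pos.ne'
  refine hasSmallPowers_sub_projection (w := fun j => u j / m) h.R_nonneg h.R_row h.R_diag hpar hr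
    (fun i => div_nonneg (hu.nonneg i) (Nat.cast_nonneg m)) ?_ ?_
  · have : (fun j => u j / (m : ℝ)) = (m : ℝ)⁻¹ • u := by ext; simp [div_eq_inv_mul]
    rw [this, Matrix.smul_vecMul, hu.eigen]
  · rw [← Finset.sum_div, hu.sum_eq, div_self hm]

/-- `C.transpose` is row-stochastic with left eigenvector `v`, and small powers survive
transposition. -/
lemma MixingAssumption.hasSmallPowers_C (h : MixingAssumption R C)
    (hv : IsRightEigenvector C v) :
    HasSmallPowers (Matrix.of fun i j => C i j - v i / (m : ℝ)) := by
  obtain ⟨r, -, ⟨parent, hpar, hr⟩⟩ := h.common_root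
  have hm : (m : ℝ) ≠ 0 := by exact_mod_cast h.pos.ne'
  refine (hasSmallPowers_sub_projection (P := C.transpose) (w := fun j => v j / m)
    (fun i j => h.C_nonneg j i) h.C_col h.C_diag hpar hr
    (fun i => div_nonneg (hv.nonneg i) (Nat.cast_nonneg m)) ?_ ?_).transpose
  · have : (fun j => v j / (m : ℝ)) = (m : ℝ)⁻¹ • v := by ext; simp [div_eq_inv_mul]
    rw [this, Matrix.vecMul_transpose, Matrix.mulVec_smul, hv.eigen]
  · rw [← Finset.sum_div, hv.sum_eq, div_self hm]

/-- The adapted norm dominates only the sup norm. The factor `m` makes it dominate the `ℓ¹` norm,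
hence the Euclidean one, without changing the contraction factor. -/
lemma HasSmallPowers.exists_isContractionNorm {A : Matrix (Fin m) (Fin m) ℝ}
    (hA : HasSmallPowers A) : ∃ N : Seminorm ℝ (Fin m → ℝ), IsContractionNorm N A := by
  obtain ⟨N, σ, c, hσ0, hσ1, -, hlow, -, hN⟩ := hA.exists_adapted_norm ℝ
  have happ : ∀ w, ((m : NNReal) • N) w = m * N w := fun w => by
    rw [smul_apply, NNReal.smul_def]; simp
  refine ⟨(m : NNReal) • N, fun w => ?_, σ, hσ0, hσ1, fun w => ?_⟩
  · rw [happ]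
    have h1 : √(∑ i, w i ^ 2) ≤ ∑ i, |w i| := by
      rw [Real.sqrt_le_left (by positivity)]
      simpa using Finset.sum_sq_le_sq_sum_of_nonneg (s := Finset.univ) (f := fun i => |w i|)
        fun _ _ => abs_nonneg _
    refine h1.trans ?_
    calc ∑ i, |w i| ≤ ∑ _i : Fin m, N w :=
          Finset.sum_le_sum fun i _ => (norm_le_pi_norm w i).trans (hlow w)
      _ = m * N w := by simp
  · rw [happ, happ]
    have := mul_le_mul_of_nonneg_left (hN w) (Nat.cast_nonneg (α := ℝ) m)
    calc _ ≤ _ := this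
      _ = _ := by ring

end MixingAssumption

/-! ### Convexity, smoothness and sublevel sets. -/

section ConvexAnalysis

variable {n : ℕ}

lemma hasGradientAt_of_contDiff {h : E n → ℝ} (hh : ContDiff ℝ 1 h) (z : E n) :
    HasGradientAt h (gradient h z) z :=
  (hh.differentiable one_ne_zero z).hasGradientAt

lemma hasDerivAt_line {h : E n → ℝ} (hh : ContDiff ℝ 1 h) (w d : E n) (t : ℝ) :
    HasDerivAt (fun t : ℝ => h (w + t • d)) (inner ℝ (gradient h (w + t • d)) d) t := by
  have h1 : HasDerivAt (fun t : ℝ => w + t • d) d t := by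
    simpa using ((hasDerivAt_id t).smul_const d).const_add w
  have h2 := (hasGradientAt_of_contDiff hh (w + t • d)).hasFDerivAt.comp_hasDerivAt t h1
  exact h2.congr_deriv (InnerProductSpace.toDual_apply_apply ..)

/-- Quadratic lower bound for a function with `μ`-strongly monotone gradient; `μ` may have
any sign. -/
lemma IsStronglyConvex.lower_bound {μ : ℝ} {h : E n → ℝ} (hh : IsStronglyConvex μ h) (w z : E n) :
    h w + inner ℝ (gradient h w) (z - w) + μ / 2 * ‖z - w‖ ^ 2 ≤ h z := by
  set d := z - w with hd
  -- `φ` is `h` on the segment minus its quadratic model; strong monotonicity makes its derivative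
  -- nonnegative, and the claim is `φ 0 ≤ φ 1`.
  set φ : ℝ → ℝ := fun t => h (w + t • d) - t * inner ℝ (gradient h w) d
    - μ / 2 * t ^ 2 * ‖d‖ ^ 2 with hφ
  have hder : ∀ t, HasDerivAt φ (inner ℝ (gradient h (w + t • d)) d - inner ℝ (gradient h w) d
      - μ * t * ‖d‖ ^ 2) t := fun t => by
    have := ((hasDerivAt_line hh.1 w d t).sub
      ((hasDerivAt_id t).mul_const (inner ℝ (gradient h w) d))).sub
      ((((hasDerivAt_id t).pow 2).const_mul (μ / 2)).mul_const (‖d‖ ^ 2))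
    refine this.congr_deriv ?_
    simp only [id_eq, one_mul, mul_one, Nat.cast_ofNat, Nat.add_one_sub_one, pow_one]
    ring
  have hmono : MonotoneOn φ (Set.Icc 0 1) := by
    refine monotoneOn_of_deriv_nonneg (convex_Icc 0 1)
      (fun t _ => (hder t).continuousAt.continuousWithinAt)
      (fun t _ => (hder t).differentiableAt.differentiableWithinAt) fun t ht => ?_
    rw [interior_Icc] at ht
    rw [(hder t).deriv, ← inner_sub_left]
    have h1 := hh.2 (w + t • d) w
    rw [add_sub_cancel_left, inner_smul_right, norm_smul, Real.norm_of_nonneg ht.1.le] at h1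
    have h2 : 0 ≤ t * (inner ℝ (gradient h (w + t • d) - gradient h w) d - μ * t * ‖d‖ ^ 2) := by
      linarith
    exact nonneg_of_mul_nonneg_right h2 ht.1
  have := hmono (Set.left_mem_Icc.2 zero_le_one) (Set.right_mem_Icc.2 zero_le_one) zero_le_one
  simp only [hφ, zero_smul, add_zero, one_smul] at this
  have hz : w + d = z := by rw [hd]; abel
  rw [hz] at this
  linarith

lemma gradient_neg_apply (h : E n → ℝ) (z : E n) : gradient (fun z => -h z) z = -gradient h z := by
  simp [gradient, fderiv_fun_neg]

/-- By Cauchy–Schwarz the gradient of `-h` is `(-L)`-strongly monotone, so the lower bound for a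
negative modulus applies. -/
lemma IsSmooth.upper_bound {L : ℝ} {h : E n → ℝ} (hh : IsSmooth L h) (w z : E n) :
    h z ≤ h w + inner ℝ (gradient h w) (z - w) + L / 2 * ‖z - w‖ ^ 2 := by
  have : IsStronglyConvex (-L) fun z => -h z := by
    refine ⟨hh.1.neg, fun x y => ?_⟩
    rw [gradient_neg_apply, gradient_neg_apply,
      show -gradient h x - -gradient h y = -(gradient h x - gradient h y) by abel, inner_neg_left]
    have h1 := (abs_le.1 (abs_real_inner_le_norm (gradient h x - gradient h y) (x - y))).2
    have h2 := mul_le_mul_of_nonneg_right (hh.2 x y) (norm_nonneg (x - y))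
    nlinarith
  have := this.lower_bound w z
  rw [gradient_neg_apply, inner_neg_left] at this
  linarith

lemma gradient_inner_le_of_convexOn {h : E n → ℝ} (hh : ContDiff ℝ 1 h)
    (hc : ConvexOn ℝ Set.univ h) (w z : E n) : h w + inner ℝ (gradient h w) (z - w) ≤ h z := by
  have h1 : ConvexOn ℝ Set.univ fun t : ℝ => h (w + t • (z - w)) := by
    have := hc.comp_affineMap (AffineMap.lineMap (k := ℝ) w z)
    rw [Set.preimage_univ] at this
    refine this.congr fun t _ => ?_
    simp [AffineMap.lineMap_apply, add_comm]
  have h2 := h1.le_slope_of_hasDerivAt (Set.mem_univ 0) (Set.mem_univ 1) zero_lt_one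
    (hasDerivAt_line hh w (z - w) 0)
  simp only [slope_def_field, zero_smul, add_zero, one_smul, add_sub_cancel, sub_zero, div_one] at h2
  linarith

lemma isStronglyConvex_zero_of_convexOn {h : E n → ℝ} (hh : ContDiff ℝ 1 h)
    (hc : ConvexOn ℝ Set.univ h) : IsStronglyConvex 0 h := by
  refine ⟨hh, fun x y => ?_⟩
  have h1 := gradient_inner_le_of_convexOn hh hc x y
  have h2 := gradient_inner_le_of_convexOn hh hc y x
  rw [← neg_sub, inner_neg_right] at h1
  rw [inner_sub_left]
  linarith

lemma gradient_total {m : ℕ} {h : Fin m → E n → ℝ} (hh : ∀ i, ContDiff ℝ 1 (h i)) (z : E n) :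
    gradient (total h) z = ∑ i, gradient (h i) z := by
  have : HasGradientAt (total h) (∑ i, gradient (h i) z) z := by
    rw [hasGradientAt_iff_hasFDerivAt, map_sum]
    exact HasFDerivAt.fun_sum fun i _ => (hasGradientAt_of_contDiff (hh i) z).hasFDerivAt
  exact this.gradient

lemma IsStronglyConvex.total {m : ℕ} {μ : ℝ} {h : Fin m → E n → ℝ}
    (hh : ∀ i, IsStronglyConvex μ (h i)) : IsStronglyConvex (m * μ) (total h) := by
  refine ⟨ContDiff.sum fun i _ => (hh i).1, fun x y => ?_⟩
  rw [gradient_total fun i => (hh i).1, gradient_total fun i => (hh i).1, ← Finset.sum_sub_distrib,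
    sum_inner]
  calc _ = ∑ _i : Fin m, μ * ‖x - y‖ ^ 2 := by simp [mul_assoc]
    _ ≤ _ := Finset.sum_le_sum fun i _ => (hh i).2 x y

lemma IsSmooth.total {m : ℕ} {L : ℝ} {h : Fin m → E n → ℝ}
    (hh : ∀ i, IsSmooth L (h i)) : IsSmooth (m * L) (total h) := by
  refine ⟨ContDiff.sum fun i _ => (hh i).1, fun x y => ?_⟩
  rw [gradient_total fun i => (hh i).1, gradient_total fun i => (hh i).1, ← Finset.sum_sub_distrib]
  calc _ ≤ ∑ _i : Fin m, L * ‖x - y‖ := norm_sum_le_of_le _ fun i _ => (hh i).2 x y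
    _ = _ := by simp [mul_assoc]

lemma gradient_add_mul {F G : E n → ℝ} (hF : ContDiff ℝ 1 F) (hG : ContDiff ℝ 1 G) (l : ℝ)
    (z : E n) : gradient (fun z => G z + l * F z) z = gradient G z + l • gradient F z := by
  have : HasGradientAt (fun z => G z + l * F z) (gradient G z + l • gradient F z) z := by
    rw [hasGradientAt_iff_hasFDerivAt, map_add, map_smul]
    exact (hasGradientAt_of_contDiff hG z).hasFDerivAt.add
      ((hasGradientAt_of_contDiff hF z).hasFDerivAt.const_mul l)
  exact this.gradient

lemma IsSmooth.add_mul {F G : E n → ℝ} {LF LG l : ℝ} (hF : IsSmooth LF F) (hG : IsSmooth LG G)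
    (hl : 0 ≤ l) : IsSmooth (LG + l * LF) fun z => G z + l * F z := by
  refine ⟨hG.1.add (contDiff_const.mul hF.1), fun x y => ?_⟩
  rw [gradient_add_mul hF.1 hG.1, gradient_add_mul hF.1 hG.1, add_sub_add_comm, ← smul_sub]
  refine (norm_add_le _ _).trans ?_
  rw [norm_smul, Real.norm_of_nonneg hl]
  nlinarith [hG.2 x y, mul_le_mul_of_nonneg_left (hF.2 x y) hl]

lemma IsStronglyConvex.add_mul {F G : E n → ℝ} {μ ν l : ℝ} (hF : IsStronglyConvex μ F)
    (hG : IsStronglyConvex ν G) (hl : 0 ≤ l) :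
    IsStronglyConvex (ν + l * μ) fun z => G z + l * F z := by
  refine ⟨hG.1.add (contDiff_const.mul hF.1), fun x y => ?_⟩
  rw [gradient_add_mul hF.1 hG.1, gradient_add_mul hF.1 hG.1, add_sub_add_comm, ← smul_sub,
    inner_add_left, real_inner_smul_left]
  nlinarith [hG.2 x y, mul_le_mul_of_nonneg_left (hF.2 x y) hl]

lemma IsStronglyConvex.isCompact_sublevel {F : E n → ℝ} {μ : ℝ} (hF : IsStronglyConvex μ F)
    (hμ : 0 < μ) (c : ℝ) : IsCompact {z | F z ≤ c} := by
  refine Metric.isCompact_of_isClosed_isBounded (isClosed_le hF.1.continuous continuous_const) ?_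
  set A := ‖gradient F 0‖
  -- Beyond this radius the quadratic term exceeds `(A + |c - F 0|) * ‖z‖`; the summand `1` gives
  -- `‖z‖ > 1`, so this also covers the constant term.
  refine (Metric.isBounded_closedBall (x := (0 : E n))
    (r := 1 + 2 / μ * (A + |c - F 0|))).subset fun z hz => ?_
  rw [mem_closedBall_zero_iff]
  by_contra! hlt
  have h1 := hF.lower_bound 0 z
  rw [sub_zero] at h1
  have h2 := (abs_le.1 (abs_real_inner_le_norm (gradient F 0) z)).1
  have hz' : F z ≤ c := hz
  have h3 : μ / 2 * ‖z‖ ^ 2 ≤ A * ‖z‖ + |c - F 0| := by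
    linarith [le_abs_self (c - F 0)]
  have h4 : 0 ≤ 2 / μ * (A + |c - F 0|) := by positivity
  have h5 : A + |c - F 0| < μ / 2 * ‖z‖ := by
    have : μ / 2 * (2 / μ * (A + |c - F 0|)) < μ / 2 * ‖z‖ :=
      mul_lt_mul_of_pos_left (by linarith) (by positivity)
    rwa [← mul_assoc, show μ / 2 * (2 / μ) = 1 by field_simp, one_mul] at this
  nlinarith [abs_nonneg (c - F 0)]

lemma isClosed_argminSet {G : E n → ℝ} (hG : Continuous G) : IsClosed (argminSet G) := by
  simp only [argminSet, Set.ofPred_forall]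
  exact isClosed_iInter fun w => isClosed_le hG continuous_const

/-! ### Tikhonov regularization of the bilevel problem. -/

section Tikhonov

variable {F G : E n → ℝ} {μ : ℝ}

lemma IsStronglyConvex.eq_of_isBilevelSolution (hF : IsStronglyConvex μ F) (hμ : 0 < μ)
    (hG : IsStronglyConvex 0 G) {z w : E n} (hz : IsBilevelSolution F G z)
    (hw : IsBilevelSolution F G w) : z = w := by
  -- The lower bounds from the midpoint to `z` and to `w` are added, and the gradient terms cancel.
  -- For `G` this puts the midpoint in the argmin; for `F` it makes it strictly better unless `z =
  -- w`.
  have mid : ∀ {ν : ℝ} {h : E n → ℝ}, IsStronglyConvex ν h →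
      2 * h ((1 / 2 : ℝ) • (z + w)) + ν * ‖(1 / 2 : ℝ) • (z - w)‖ ^ 2 ≤ h z + h w := by
    intro ν h hh
    have h1 := hh.lower_bound ((1 / 2 : ℝ) • (z + w)) z
    have h2 := hh.lower_bound ((1 / 2 : ℝ) • (z + w)) w
    have e1 : z - (1 / 2 : ℝ) • (z + w) = (1 / 2 : ℝ) • (z - w) := by module
    have e2 : w - (1 / 2 : ℝ) • (z + w) = -((1 / 2 : ℝ) • (z - w)) := by module
    rw [e1] at h1
    rw [e2, inner_neg_right, norm_neg] at h2
    linarith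
  have hmem : (1 / 2 : ℝ) • (z + w) ∈ argminSet G := fun y => by
    have := mid hG
    linarith [hz.1 y, hw.1 y]
  have h1 := mid hF
  have h2 := hz.2 _ hmem
  have h3 := hw.2 _ hmem
  have h4 : ‖(1 / 2 : ℝ) • (z - w)‖ ^ 2 ≤ 0 := by
    by_contra! hlt
    have := mul_pos hμ hlt
    linarith
  have h5 : (1 / 2 : ℝ) • (z - w) = 0 := by
    rw [← norm_eq_zero]
    exact pow_eq_zero_iff two_ne_zero |>.1 (le_antisymm h4 (sq_nonneg _))
  rw [smul_eq_zero_iff_right (by norm_num), sub_eq_zero] at h5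
  exact h5

lemma IsStronglyConvex.existsUnique_isBilevelSolution (hF : IsStronglyConvex μ F) (hμ : 0 < μ)
    (hG : IsStronglyConvex 0 G) (hne : (argminSet G).Nonempty) :
    ∃ xstar, ∀ z, IsBilevelSolution F G z ↔ z = xstar := by
  obtain ⟨p, hp⟩ := hne
  obtain ⟨z, ⟨hz, hzp⟩, hmin⟩ := ((hF.isCompact_sublevel hμ (F p)).inter_left
    (isClosed_argminSet hG.1.continuous)).exists_isMinOn ⟨p, hp, le_refl (F p)⟩
    hF.1.continuous.continuousOn
  have hsol : IsBilevelSolution F G z := by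
    refine ⟨hz, fun w hw => ?_⟩
    rcases le_total (F w) (F p) with h | h
    · exact hmin ⟨hw, h⟩
    · exact le_trans hzp h
  exact ⟨z, fun w => ⟨fun hw => hF.eq_of_isBilevelSolution hμ hG hw hsol, fun h => h ▸ hsol⟩⟩

/-- For `p` minimizing `G`, both summands are at least their values at `p` outside the compact set
`{F ≤ F p}`, so minimizing over that set is enough. -/
lemma IsStronglyConvex.exists_regularized_minimizer (hF : IsStronglyConvex μ F) (hμ : 0 < μ)
    (hG : IsStronglyConvex 0 G) (hne : (argminSet G).Nonempty) {l : ℝ} (hl : 0 < l) :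
    ∃ z, z ∈ argminSet fun z => G z + l * F z := by
  obtain ⟨p, hp⟩ := hne
  obtain ⟨z, -, hmin⟩ := (hF.isCompact_sublevel hμ (F p)).exists_isMinOn
    ⟨p, le_refl (F p)⟩ (hG.1.continuous.add (continuous_const.mul hF.1.continuous)).continuousOn
    (f := fun z => G z + l * F z)
  refine ⟨z, fun w => ?_⟩
  rcases le_total (F w) (F p) with h | h
  · exact hmin h
  · have h1 : G z + l * F z ≤ G p + l * F p := hmin (le_refl (F p))
    have h2 := mul_le_mul_of_nonneg_left h hl.le
    have h3 := hp w
    show G z + l * F z ≤ G w + l * F w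
    linarith

lemma gradient_eq_zero_of_mem_argminSet {h : E n → ℝ} {z : E n} (hz : z ∈ argminSet h) :
    gradient h z = 0 := by
  have : IsLocalMin h z := Eventually.of_forall hz
  rw [gradient, this.fderiv_eq_zero, map_zero]

lemma le_of_mem_argminSet_regularized {l : ℝ} (hl : 0 < l) {xstar z : E n}
    (hx : xstar ∈ argminSet G) (hz : z ∈ argminSet fun z => G z + l * F z) :
    F z ≤ F xstar := by
  have h1 : G z + l * F z ≤ G xstar + l * F xstar := hz xstar
  have h2 := hx z
  exact le_of_mul_le_mul_left (by linarith) hl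

/-- The minimizers of `G + l • F` converge to the solution of the bilevel problem as `l → 0`. -/
lemma IsStronglyConvex.tendsto_regularized_minimizer (hF : IsStronglyConvex μ F) (hμ : 0 < μ)
    (hG : Continuous G) {xstar : E n}
    (hx : ∀ z, IsBilevelSolution F G z ↔ z = xstar) {l : ℕ → ℝ} (hl : ∀ k, 0 < l k)
    (hl0 : Tendsto l atTop (𝓝 0)) {z : ℕ → E n}
    (hz : ∀ k, z k ∈ argminSet fun z => G z + l k * F z) :
    Tendsto z atTop (𝓝 xstar) := by
  have hsol := (hx xstar).2 rfl
  have hFz : ∀ k, F (z k) ≤ F xstar := fun k =>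
    le_of_mem_argminSet_regularized (hl k) hsol.1 (hz k)
  have hcpt := hF.isCompact_sublevel hμ (F xstar)
  have hcl := hcpt.isClosed
  -- The path stays in a compact sublevel set of `F`, so it suffices that every cluster point solves
  -- the bilevel problem. Minimality in `G` follows from `G (z k) ≤ G xstar + l k * (F xstar - F
  -- p)`, with `p` minimizing `F` there.
  refine hcpt.tendsto_nhds_of_unique_mapClusterPt (Eventually.of_forall hFz) fun y hy hyc => ?_
  obtain ⟨p, -, hp⟩ := hcpt.exists_isMinOn ⟨xstar, le_refl (F xstar)⟩ hF.1.continuous.continuousOn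
  have hy' : F y ≤ F xstar := hy
  refine (hx y).1 ⟨fun w => ?_, fun w hw => hy'.trans (hsol.2 w hw)⟩
  refine le_trans ?_ (hsol.1 w)
  refine le_of_forall_pos_le_add fun ε hε => ?_
  have hlim : Tendsto (fun k => l k * (F xstar - F p)) atTop (𝓝 0) := by
    simpa using hl0.mul_const (F xstar - F p)
  have hev : ∀ᶠ k in atTop, z k ∈ {w | G w ≤ G xstar + ε} := by
    filter_upwards [hlim.eventually_le_const hε] with k hk
    have h1 : G (z k) + l k * F (z k) ≤ G xstar + l k * F xstar := hz k xstar
    have h2 : F p ≤ F (z k) := hp (hFz k)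
    have h3 := mul_le_mul_of_nonneg_left h2 (hl k).le
    show G (z k) ≤ G xstar + ε
    linarith
  exact (isClosed_le hG continuous_const).mem_of_mapClusterPt hyc hev

/-- The gradient of `G + l F` vanishes at `z` and equals `(l - l') ∇F z'` at `z'`; its strong
monotonicity with modulus `l * μ` compares the two points. -/
lemma IsStronglyConvex.regularized_minimizer_lipschitz (hF : IsStronglyConvex μ F)
    (hG : IsStronglyConvex 0 G) {l l' : ℝ} (hl : 0 < l) {z z' : E n}
    (hz : z ∈ argminSet fun z => G z + l * F z) (hz' : z' ∈ argminSet fun z => G z + l' * F z) :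
    l * μ * ‖z - z'‖ ≤ |l - l'| * ‖gradient F z'‖ := by
  rcases (norm_nonneg (z - z')).eq_or_lt' with h0 | h0
  · rw [h0, mul_zero]; positivity
  have e1 := gradient_eq_zero_of_mem_argminSet hz
  have e2 := gradient_eq_zero_of_mem_argminSet hz'
  rw [gradient_add_mul hF.1 hG.1] at e1 e2
  have h1 := (hF.add_mul hG hl.le).2 z z'
  rw [gradient_add_mul hF.1 hG.1, gradient_add_mul hF.1 hG.1, e1,
    show gradient G z' = -(l' • gradient F z') from eq_neg_of_add_eq_zero_left e2, zero_add,
    show (0 : E n) - (-(l' • gradient F z') + l • gradient F z') = (l' - l) • gradient F z' by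
      module, real_inner_smul_left] at h1
  have h2 : (l' - l) * inner ℝ (gradient F z') (z - z') ≤
      |l - l'| * (‖gradient F z'‖ * ‖z - z'‖) := by
    refine (le_abs_self _).trans ?_
    rw [abs_mul, abs_sub_comm]
    exact mul_le_mul_of_nonneg_left (abs_real_inner_le_norm _ _) (abs_nonneg _)
  refine le_of_mul_le_mul_right ?_ h0
  nlinarith

/-- One gradient step with a small step size contracts towards the minimizer. -/
lemma IsStronglyConvex.norm_gradient_step_le {h : E n → ℝ} {L α : ℝ} (hh : IsStronglyConvex μ h)
    (hL : IsSmooth L h) (hα : 0 ≤ α) (hαL : α * L ^ 2 ≤ μ) (hαμ : α * μ ≤ 1) {z : E n}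
    (hz : gradient h z = 0) (w : E n) :
    ‖w - α • gradient h w - z‖ ≤ (1 - α * μ / 2) * ‖w - z‖ := by
  have h1 := hh.2 w z
  have h2 := hL.2 w z
  rw [hz, sub_zero] at h1 h2
  have h3 : ‖gradient h w‖ ^ 2 ≤ L ^ 2 * ‖w - z‖ ^ 2 := by
    rw [← mul_pow]; exact pow_le_pow_left₀ (norm_nonneg _) h2 2
  refine le_of_sq_le_sq ?_ (mul_nonneg (by linarith) (norm_nonneg _))
  rw [show w - α • gradient h w - z = (w - z) - α • gradient h w by abel, norm_sub_sq_real,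
    real_inner_smul_right, norm_smul, mul_pow, real_inner_comm, mul_pow, Real.norm_eq_abs, sq_abs]
  have h4 := mul_le_mul_of_nonneg_left h1 hα
  have h5 := mul_le_mul_of_nonneg_left h3 (sq_nonneg α)
  -- The squared factor is at most `1 - 2αμ + α²L² ≤ 1 - αμ ≤ (1 - αμ / 2)²`.
  have h6 : α * (α * L ^ 2) * ‖w - z‖ ^ 2 ≤ α * μ * ‖w - z‖ ^ 2 :=
    mul_le_mul_of_nonneg_right (mul_le_mul_of_nonneg_left hαL hα) (sq_nonneg _)
  nlinarith [sq_nonneg (α * μ * ‖w - z‖)]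

end Tikhonov

end ConvexAnalysis

/-! ### Weighted averages and their invariance under mixing. -/

section Averages

open scoped Matrix.Module

variable {m n : ℕ}

lemma wavg_add (w : Fin m → ℝ) (W W' : Fin m → E n) :
    wavg w (W + W') = wavg w W + wavg w W' := by
  simp [wavg, smul_add, Finset.sum_add_distrib]

lemma wavg_sub (w : Fin m → ℝ) (W W' : Fin m → E n) :
    wavg w (W - W') = wavg w W - wavg w W' := by
  simp [wavg, smul_sub, Finset.sum_sub_distrib]

lemma norm_wavg_le {w : Fin m → ℝ} (hm : 0 < m) (hw : ∀ i, 0 ≤ w i) (hsum : ∑ i, w i = m)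
    (W : Fin m → E n) : ‖wavg w W‖ ≤ ‖W‖ := by
  have hm' : (0 : ℝ) < m := by exact_mod_cast hm
  rw [wavg, norm_smul, Real.norm_of_nonneg (by positivity), one_div, inv_mul_le_iff₀ hm', ← hsum,
    Finset.sum_mul]
  refine norm_sum_le_of_le _ fun i _ => ?_
  rw [norm_smul, Real.norm_of_nonneg (hw i)]
  exact mul_le_mul_of_nonneg_left (norm_le_pi_norm W i) (hw i)

lemma norm_wavg_one_le (hm : 0 < m) (W : Fin m → E n) : ‖wavg 1 W‖ ≤ ‖W‖ :=
  norm_wavg_le hm (fun _ => zero_le_one) (by simp) W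

lemma wavg_const {w : Fin m → ℝ} (hm : 0 < m) (hsum : ∑ i, w i = m) (c : E n) :
    wavg w (fun _ => c) = c := by
  have hm' : (m : ℝ) ≠ 0 := by exact_mod_cast hm.ne'
  rw [wavg, ← Finset.sum_smul, hsum, smul_smul, one_div_mul_cancel hm', one_smul]

lemma norm_smul_const_le (v : Fin m → ℝ) (c : E n) :
    ‖(fun i => v i • c : Fin m → E n)‖ ≤ ‖v‖ * ‖c‖ := by
  refine (pi_norm_le_iff_of_nonneg (by positivity)).2 fun i => ?_
  rw [norm_smul]
  exact mul_le_mul_of_nonneg_right (norm_le_pi_norm v i) (norm_nonneg c)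

lemma norm_pi_const_le (c : E n) : ‖(fun _ => c : Fin m → E n)‖ ≤ ‖c‖ :=
  (pi_norm_le_iff_of_nonneg (norm_nonneg c)).2 fun _ => le_rfl

variable {R C : Matrix (Fin m) (Fin m) ℝ} {u v : Fin m → ℝ}

lemma wavg_smul_of_vecMul {w : Fin m → ℝ} {B : Matrix (Fin m) (Fin m) ℝ}
    (hw : Matrix.vecMul w B = w) (W : Fin m → E n) : wavg w (B • W) = wavg w W := by
  rw [wavg, wavg]
  congr 1
  simp only [Matrix.Module.smul_apply, Finset.smul_sum, smul_smul]
  rw [Finset.sum_comm]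
  refine Finset.sum_congr rfl fun j _ => ?_
  rw [← Finset.sum_smul]
  congr 1
  exact congrFun hw j

lemma vecMul_one_of_colSum (hC : ∀ j, ∑ i, C i j = 1) : Matrix.vecMul 1 C = 1 := by
  ext j
  simpa [Matrix.vecMul, dotProduct] using hC j

lemma sub_row_smul (W : Fin m → E n) :
    (Matrix.of fun i j => R i j - u j / (m : ℝ)) • W = R • W - fun _ => wavg u W := by
  ext1 i
  simp [wavg, sub_smul, Finset.sum_sub_distrib, Finset.smul_sum, smul_smul, div_eq_inv_mul]

lemma sub_col_smul (W : Fin m → E n) :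
    (Matrix.of fun i j => C i j - v i / (m : ℝ)) • W = C • W - fun i => v i • wavg 1 W := by
  ext1 i
  simp [wavg, sub_smul, Finset.sum_sub_distrib, Finset.smul_sum, smul_smul, div_eq_mul_inv]

lemma smul_const_of_rowSum (hR : ∀ i, ∑ j, R i j = 1) (c : E n) :
    R • (fun _ => c : Fin m → E n) = fun _ => c := by
  ext1 i
  rw [Matrix.Module.smul_apply, ← Finset.sum_smul, hR, one_smul]

lemma smul_smul_const_of_mulVec (hv : Matrix.mulVec C v = v) (c : E n) :
    C • (fun i => v i • c : Fin m → E n) = fun i => v i • c := by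
  ext1 i
  simp only [Matrix.Module.smul_apply, smul_smul]
  rw [← Finset.sum_smul]
  congr 1
  exact congrFun hv i

end Averages

/-! ### Regularized path and exact error dynamics. -/

section Dynamics

open scoped Matrix.Module

variable {m n : ℕ} {f g : Fin m → E n → ℝ} {μf Lf Lg : ℝ} {R C : Matrix (Fin m) (Fin m) ℝ}
  {u v : Fin m → ℝ} {γ : ℕ → Fin m → ℝ} {lam : ℕ → ℝ} {a b θ : ℝ} {x y : ℕ → Fin m → E n}

/-- The stacked gradients of the regularized local objectives. -/
def stackedGradient (f g : Fin m → E n → ℝ) (l : ℝ) (W : Fin m → E n) : Fin m → E n :=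
  fun i => gradient (g i) (W i) + l • gradient (f i) (W i)

/-- The global regularized objective. -/
def regularized (f g : Fin m → E n → ℝ) (l : ℝ) (z : E n) : ℝ := total g z + l * total f z

lemma ProblemAssumption.total_f_strong (h : ProblemAssumption f g μf Lf Lg) :
    IsStronglyConvex (m * μf) (total f) := .total h.f_strong

lemma ProblemAssumption.total_g_convex (h : ProblemAssumption f g μf Lf Lg) :
    IsStronglyConvex 0 (total g) := by
  simpa using IsStronglyConvex.total fun i =>
    isStronglyConvex_zero_of_convexOn (h.g_smooth i).1 (h.g_convex i)

lemma ProblemAssumption.gradient_regularized (h : ProblemAssumption f g μf Lf Lg) (l : ℝ)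
    (z : E n) :
    gradient (regularized f g l) z = ∑ i, (gradient (g i) z + l • gradient (f i) z) := by
  have := gradient_add_mul h.total_f_strong.1 h.total_g_convex.1 l z
  rw [gradient_total fun i => (h.f_smooth i).1, gradient_total fun i => (h.g_smooth i).1,
    Finset.smul_sum, ← Finset.sum_add_distrib] at this
  exact this

lemma ProblemAssumption.wavg_stackedGradient_const (h : ProblemAssumption f g μf Lf Lg) (l : ℝ)
    (z : E n) : wavg 1 (stackedGradient f g l fun _ => z)
      = (1 / (m : ℝ)) • gradient (regularized f g l) z := by
  rw [h.gradient_regularized]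
  simp [wavg, stackedGradient]

lemma ProblemAssumption.regularized_strong (h : ProblemAssumption f g μf Lf Lg) {l : ℝ}
    (hl : 0 ≤ l) : IsStronglyConvex (l * (m * μf)) (regularized f g l) := by
  have := h.total_f_strong.add_mul h.total_g_convex hl
  rwa [zero_add] at this

lemma ProblemAssumption.regularized_smooth (h : ProblemAssumption f g μf Lf Lg) {l l₀ : ℝ}
    (hl : 0 ≤ l) (hl₀ : l ≤ l₀) : IsSmooth (m * (Lg + l₀ * Lf)) (regularized f g l) := by
  have := (IsSmooth.total h.f_smooth).add_mul (IsSmooth.total h.g_smooth) hl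
  refine ⟨this.1, fun x y => (this.2 x y).trans (mul_le_mul_of_nonneg_right ?_ (norm_nonneg _))⟩
  have h1 := mul_le_mul_of_nonneg_right hl₀ (mul_nonneg (Nat.cast_nonneg (α := ℝ) m) h.Lf_pos.le)
  linarith

lemma ProblemAssumption.norm_stackedGradient_sub_le (h : ProblemAssumption f g μf Lf Lg)
    {l l₀ : ℝ} (hl : 0 ≤ l) (hl₀ : l ≤ l₀) (W W' : Fin m → E n) :
    ‖stackedGradient f g l W - stackedGradient f g l W'‖ ≤ (Lg + l₀ * Lf) * ‖W - W'‖ := by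
  have hLg := h.Lg_pos
  have hLf := h.Lf_pos
  have hl₀0 : 0 ≤ l₀ := hl.trans hl₀
  refine (pi_norm_le_iff_of_nonneg (by positivity)).2 fun i => ?_
  have hi : ‖W i - W' i‖ ≤ ‖W - W'‖ := norm_le_pi_norm (W - W') i
  calc ‖stackedGradient f g l W i - stackedGradient f g l W' i‖
      = ‖(gradient (g i) (W i) - gradient (g i) (W' i))
          + l • (gradient (f i) (W i) - gradient (f i) (W' i))‖ := by
        rw [stackedGradient, stackedGradient, smul_sub, add_sub_add_comm]
    _ ≤ Lg * ‖W i - W' i‖ + l * (Lf * ‖W i - W' i‖) := by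
        refine norm_add_le_of_le ((h.g_smooth i).2 _ _) ?_
        rw [norm_smul, Real.norm_of_nonneg hl]
        exact mul_le_mul_of_nonneg_left ((h.f_smooth i).2 _ _) hl
    _ ≤ Lg * ‖W - W'‖ + l₀ * (Lf * ‖W - W'‖) := by gcongr
    _ = _ := by ring

lemma norm_stackedGradient_sub_param (l l' : ℝ) (W : Fin m → E n) {M : ℝ} (hM : 0 ≤ M)
    (hf : ∀ i, ‖gradient (f i) (W i)‖ ≤ M) :
    ‖stackedGradient f g l W - stackedGradient f g l' W‖ ≤ |l - l'| * M := by
  refine (pi_norm_le_iff_of_nonneg (by positivity)).2 fun i => ?_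
  have : (stackedGradient f g l W - stackedGradient f g l' W) i
      = (l - l') • gradient (f i) (W i) := by
    simp only [stackedGradient, Pi.sub_apply, sub_smul]
    abel
  rw [this, norm_smul, Real.norm_eq_abs]
  exact mul_le_mul_of_nonneg_left (hf i) (abs_nonneg _)

lemma UpdateRules.lam_eq_powerDecay (h : UpdateRules u v γ lam a b θ) (k : ℕ) :
    lam k = lam 0 * powerDecay b k := by
  rw [h.lam_eq, powerDecay, Real.rpow_neg (by positivity), div_eq_mul_inv]

lemma UpdateRules.maxStep_eq_powerDecay (h : UpdateRules u v γ lam a b θ) (k : ℕ) :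
    maxStep γ k = maxStep γ 0 * powerDecay a k := by
  rw [h.maxStep_eq, powerDecay, Real.rpow_neg (by positivity), div_eq_mul_inv]

lemma UpdateRules.lam_pos' (h : UpdateRules u v γ lam a b θ) (k : ℕ) : 0 < lam k := by
  rw [h.lam_eq_powerDecay]
  exact mul_pos h.lam_pos (powerDecay_pos _ _)

lemma UpdateRules.lam_le (h : UpdateRules u v γ lam a b θ) (k : ℕ) : lam k ≤ lam 0 := by
  rw [h.lam_eq_powerDecay]
  exact mul_le_of_le_one_right h.lam_pos.le (powerDecay_le_one h.b_pos.le _)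

lemma UpdateRules.tendsto_lam (h : UpdateRules u v γ lam a b θ) : Tendsto lam atTop (𝓝 0) := by
  simpa [← h.lam_eq_powerDecay] using (tendsto_powerDecay h.b_pos).const_mul (lam 0)

/-- The factor `lam k` matters: it cancels against the strong convexity modulus, proportional to
`lam k`, and leaves a drift of the path of order `1 / k`. -/
lemma UpdateRules.abs_lam_sub_le (h : UpdateRules u v γ lam a b θ) (k : ℕ) :
    |lam (k + 1) - lam k| ≤ lam k * powerDecay 1 k := by
  have h1 := powerDecay_succ_ge (p := b) (by linarith [h.b_lt_a, h.a_lt_one]) k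
  have h2 : powerDecay b (k + 1) ≤ powerDecay b k :=
    Real.rpow_le_rpow_of_nonpos (by positivity) (by push_cast; linarith) (by linarith [h.b_pos])
  have h3 := mul_le_mul_of_nonneg_left h1 h.lam_pos.le
  have h4 := mul_le_mul_of_nonneg_left h2 h.lam_pos.le
  have h5 := mul_nonneg (h.lam_pos' k).le (powerDecay_pos 1 k).le
  rw [abs_le]
  rw [h.lam_eq_powerDecay k] at h5 ⊢
  rw [h.lam_eq_powerDecay (k + 1)]
  constructor <;> linarith

lemma UpdateRules.step_le (h : UpdateRules u v γ lam a b θ) (k : ℕ) (i : Fin m) :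
    γ k i ≤ maxStep γ 0 * powerDecay a k := by
  rw [← h.maxStep_eq_powerDecay]
  exact le_ciSup (Set.finite_range (γ k)).bddAbove i

lemma UpdateRules.norm_step_smul_le (h : UpdateRules u v γ lam a b θ) (k : ℕ)
    (W : Fin m → E n) :
    ‖(fun i => γ k i • W i : Fin m → E n)‖ ≤ maxStep γ 0 * powerDecay a k * ‖W‖ := by
  have := h.maxStep_pos
  have := powerDecay_pos a k
  refine (pi_norm_le_iff_of_nonneg (by positivity)).2 fun i => ?_
  rw [norm_smul, Real.norm_of_nonneg (h.γ_nonneg k i)]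
  exact mul_le_mul (h.step_le k i) (norm_le_pi_norm W i) (norm_nonneg _) (by positivity)

lemma UpdateRules.effStep_le (h : UpdateRules u v γ lam a b θ) (hm : 0 < m)
    (hu : IsLeftEigenvector R u) (k : ℕ) :
    effStep u v γ k ≤ maxStep γ 0 * powerDecay a k * ‖v‖ := by
  have hm' : (0 : ℝ) < m := by exact_mod_cast hm
  have := h.maxStep_pos
  have := powerDecay_pos a k
  rw [effStep, one_div, inv_mul_le_iff₀ hm', ← hu.sum_eq, Finset.sum_mul]
  refine Finset.sum_le_sum fun i _ => ?_
  rw [mul_assoc]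
  refine mul_le_mul_of_nonneg_left ?_ (hu.nonneg i)
  exact (mul_le_mul_of_nonneg_left ((le_abs_self _).trans (norm_le_pi_norm v i))
    (h.γ_nonneg k i)).trans (mul_le_mul_of_nonneg_right (h.step_le k i) (norm_nonneg v))

lemma UpdateRules.effStep_ge' (h : UpdateRules u v γ lam a b θ) (k : ℕ) :
    θ * maxStep γ 0 * powerDecay a k ≤ effStep u v γ k := by
  rw [mul_assoc, ← h.maxStep_eq_powerDecay]
  exact h.effStep_ge k

/-- The minimizers of the regularized objectives: they converge to the bilevel solution and vary
by `O(1 / k)`, and the local gradients are bounded along them. -/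
lemma exists_regularized_path (hprob : ProblemAssumption f g μf Lf Lg) (hm : 0 < m)
    (hupd : UpdateRules u v γ lam a b θ) {xstar : E n}
    (hx : ∀ z, IsBilevelSolution (total f) (total g) z ↔ z = xstar) :
    ∃ z : ℕ → E n, (∀ k, z k ∈ argminSet (regularized f g (lam k))) ∧
      Tendsto z atTop (𝓝 xstar) ∧ (∃ M, 0 ≤ M ∧ ∀ k i, ‖gradient (f i) (z k)‖ ≤ M) ∧
      ∃ c, 0 ≤ c ∧ ∀ k, ‖z k - z (k + 1)‖ ≤ c * powerDecay 1 k := by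
  have hF := hprob.total_f_strong
  have hG := hprob.total_g_convex
  have hμ : 0 < m * μf := mul_pos (by exact_mod_cast hm) hprob.μf_pos
  choose z hz using fun k => hF.exists_regularized_minimizer hμ hG hprob.argmin_nonempty
    (hupd.lam_pos' k)
  have hlim := hF.tendsto_regularized_minimizer hμ hG.1.continuous hx hupd.lam_pos'
    hupd.tendsto_lam hz
  obtain ⟨r, hr⟩ := (Metric.isBounded_range_of_tendsto z hlim).subset_closedBall xstar
  have hr' : ∀ k, ‖z k - xstar‖ ≤ r := fun k => by
    simpa [dist_eq_norm] using hr (Set.mem_range_self k)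
  have hr0 : 0 ≤ r := (norm_nonneg _).trans (hr' 0)
  have hLf := hprob.Lf_pos
  set M := ∑ i, ‖gradient (f i) xstar‖ + Lf * r with hMdef
  have hM0 : 0 ≤ M := by positivity
  have hM : ∀ k i, ‖gradient (f i) (z k)‖ ≤ M := fun k i => by
    have h1 := (hprob.f_smooth i).2 (z k) xstar
    have h2 := norm_le_norm_add_norm_sub' (gradient (f i) (z k)) (gradient (f i) xstar)
    have h3 := Finset.single_le_sum (f := fun i => ‖gradient (f i) xstar‖)
      (fun _ _ => norm_nonneg _) (Finset.mem_univ i)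
    have h4 := mul_le_mul_of_nonneg_left (hr' k) hLf.le
    linarith
  refine ⟨z, hz, hlim, ⟨M, hM0, hM⟩, M / μf, div_nonneg hM0 hprob.μf_pos.le, fun k => ?_⟩
  have h1 := hF.regularized_minimizer_lipschitz hG (hupd.lam_pos' k) (hz k) (hz (k + 1))
  have h2 : ‖gradient (total f) (z (k + 1))‖ ≤ m * M := by
    rw [gradient_total fun i => (hprob.f_smooth i).1]
    refine (norm_sum_le_of_le _ fun i _ => hM (k + 1) i).trans (by simp)
  have h3 := hupd.abs_lam_sub_le k
  rw [abs_sub_comm] at h3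
  have h4 := mul_le_mul h3 h2 (norm_nonneg _)
    (mul_nonneg (hupd.lam_pos' k).le (powerDecay_pos 1 k).le)
  have hlm : 0 < lam k * m := mul_pos (hupd.lam_pos' k) (by exact_mod_cast hm)
  rw [div_mul_eq_mul_div, le_div_iff₀ hprob.μf_pos]
  refine le_of_mul_le_mul_left ?_ hlm
  linarith

lemma IsIterates.x_succ_eq (hxy : IsIterates f g R C γ lam x y) (k : ℕ) :
    x (k + 1) = R • (x k - fun i => γ k i • y k i) := by
  ext1 i
  exact hxy.x_succ k i

lemma IsIterates.y_succ_eq (hxy : IsIterates f g R C γ lam x y) (k : ℕ) :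
    y (k + 1) = C • y k + (stackedGradient f g (lam (k + 1)) (x (k + 1))
      - stackedGradient f g (lam k) (x k)) := by
  ext1 i
  rw [hxy.y_succ k i]
  simp only [Pi.add_apply, Pi.sub_apply, stackedGradient, Matrix.Module.smul_apply]
  abel

lemma IsIterates.wavg_x_succ (hxy : IsIterates f g R C γ lam x y) (hu : IsLeftEigenvector R u)
    (k : ℕ) : wavg u (x (k + 1)) = wavg u (x k) - wavg u fun i => γ k i • y k i := by
  rw [hxy.x_succ_eq, wavg_smul_of_vecMul hu.eigen, wavg_sub]

/-- Gradient tracking: the average of `y k` is the average of the local gradients. -/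
lemma IsIterates.wavg_y (hxy : IsIterates f g R C γ lam x y) (hmix : MixingAssumption R C)
    (k : ℕ) : wavg 1 (y k) = wavg 1 (stackedGradient f g (lam k) (x k)) := by
  induction k with
  | zero => exact congrArg _ (funext hxy.y_zero)
  | succ k ih =>
    rw [hxy.y_succ_eq, wavg_add, wavg_smul_of_vecMul (vecMul_one_of_colSum hmix.C_col), ih,
      wavg_sub]
    abel

/-- The consensus violation of the estimates. -/
def xDeviation (u : Fin m → ℝ) (W : Fin m → E n) : Fin m → E n := fun i => W i - wavg u W

/-- The deviation of the gradient trackers from the multiple of `v` given by their average. -/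
def yDeviation (v : Fin m → ℝ) (W : Fin m → E n) : Fin m → E n := fun i => W i - v i • wavg 1 W

/-- `R - 1uᵀ/m` annihilates consensus vectors, so `x k` may be replaced by its deviation. -/
lemma IsIterates.xDeviation_succ (hxy : IsIterates f g R C γ lam x y)
    (hmix : MixingAssumption R C) (hu : IsLeftEigenvector R u) (k : ℕ) :
    xDeviation u (x (k + 1)) = (Matrix.of fun i j => R i j - u j / (m : ℝ)) •
      (xDeviation u (x k) - fun i => γ k i • y k i) := by
  have h0 : (Matrix.of fun i j => R i j - u j / (m : ℝ)) •
      (fun _ => wavg u (x k) : Fin m → E n) = 0 := by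
    rw [sub_row_smul, smul_const_of_rowSum hmix.R_row, wavg_const hmix.pos hu.sum_eq, sub_self]
  have h1 : (xDeviation u (x k) - fun i => γ k i • y k i)
      = (x k - fun i => γ k i • y k i) - fun _ => wavg u (x k) := by
    ext1 i
    simp only [xDeviation, Pi.sub_apply]
    abel
  rw [h1, smul_sub, h0, sub_zero, sub_row_smul, ← hxy.x_succ_eq, wavg_sub,
    ← hxy.wavg_x_succ hu]
  rfl

/-- `C - v1ᵀ/m` annihilates multiples of `v`, so only the deviation of `y k` and the change of the
gradients remain. -/
lemma IsIterates.yDeviation_succ (hxy : IsIterates f g R C γ lam x y)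
    (hmix : MixingAssumption R C) (hv : IsRightEigenvector C v) (k : ℕ) :
    yDeviation v (y (k + 1)) = (Matrix.of fun i j => C i j - v i / (m : ℝ)) • yDeviation v (y k)
      + yDeviation v (stackedGradient f g (lam (k + 1)) (x (k + 1))
        - stackedGradient f g (lam k) (x k)) := by
  have hvv : wavg 1 (fun i => v i • wavg 1 (y k)) = wavg 1 (y k) := by
    simpa [wavg] using wavg_const (w := v) hmix.pos hv.sum_eq (wavg 1 (y k))
  have h0 : (Matrix.of fun i j => C i j - v i / (m : ℝ)) •
      (fun i => v i • wavg 1 (y k) : Fin m → E n) = 0 := by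
    rw [sub_col_smul, smul_smul_const_of_mulVec hv.eigen, hvv, sub_self]
  have h1 : yDeviation v (y k) = y k - fun i => v i • wavg 1 (y k) := rfl
  rw [h1, smul_sub, h0, sub_zero, sub_col_smul]
  ext1 i
  simp only [yDeviation, Pi.add_apply, Pi.sub_apply]
  rw [hxy.y_succ_eq, wavg_add, wavg_smul_of_vecMul (vecMul_one_of_colSum hmix.C_col)]
  simp only [Pi.add_apply, Pi.sub_apply, smul_add]
  abel

lemma norm_sub_const_le (W : Fin m → E n) (z : E n) :
    ‖W - fun _ => z‖ ≤ ‖xDeviation u W‖ + ‖wavg u W - z‖ := by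
  have : (W - fun _ => z) = xDeviation u W + fun _ => wavg u W - z := by
    ext1 i
    simp [xDeviation]
  rw [this]
  exact norm_add_le_of_le le_rfl (norm_pi_const_le _)

lemma norm_yDeviation_le (hm : 0 < m) (W : Fin m → E n) :
    ‖yDeviation v W‖ ≤ (1 + ‖v‖) * ‖W‖ := by
  have : yDeviation v W = W - fun i => v i • wavg 1 W := rfl
  rw [this, add_mul, one_mul]
  exact norm_sub_le_of_le le_rfl ((norm_smul_const_le _ _).trans
    (mul_le_mul_of_nonneg_left (norm_wavg_one_le hm W) (norm_nonneg v)))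

end Dynamics

/-! ### Error inequalities and their rates. -/

section Rates

open scoped Matrix.Module

variable {m n : ℕ} {f g : Fin m → E n → ℝ} {μf Lf Lg : ℝ} {R C : Matrix (Fin m) (Fin m) ℝ}
  {u v : Fin m → ℝ} {γ : ℕ → Fin m → ℝ} {lam : ℕ → ℝ} {a b θ : ℝ} {x y : ℕ → Fin m → E n}

/-- The mean of `y k` is the mean of the local gradients at `x k`, which vanishes when all agents
sit at `z`; the rest is Lipschitz continuity. -/
lemma IsIterates.norm_wavg_y_le (hxy : IsIterates f g R C γ lam x y)
    (hprob : ProblemAssumption f g μf Lf Lg) (hmix : MixingAssumption R C)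
    (hupd : UpdateRules u v γ lam a b θ) {k : ℕ} {z : E n}
    (hz : z ∈ argminSet (regularized f g (lam k))) :
    ‖wavg 1 (y k)‖ ≤
      (Lg + lam 0 * Lf) * (‖xDeviation u (x k)‖ + ‖wavg u (x k) - z‖) := by
  have h0 : wavg 1 (stackedGradient f g (lam k) fun _ => z) = 0 := by
    rw [hprob.wavg_stackedGradient_const, gradient_eq_zero_of_mem_argminSet hz, smul_zero]
  rw [hxy.wavg_y hmix, ← sub_zero (wavg 1 _), ← h0, ← wavg_sub]
  have hL : 0 ≤ Lg + lam 0 * Lf :=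
    add_nonneg hprob.Lg_pos.le (mul_nonneg hupd.lam_pos.le hprob.Lf_pos.le)
  exact (norm_wavg_one_le hmix.pos _).trans <|
    (hprob.norm_stackedGradient_sub_le (hupd.lam_pos' k).le (hupd.lam_le k) _ _).trans <|
    mul_le_mul_of_nonneg_left (norm_sub_const_le _ _) hL

lemma norm_le_yDeviation_add (W : Fin m → E n) :
    ‖W‖ ≤ ‖yDeviation v W‖ + ‖v‖ * ‖wavg 1 W‖ := by
  have : W = yDeviation v W + fun i => v i • wavg 1 W := by
    ext1 i
    simp [yDeviation]
  calc ‖W‖ = ‖yDeviation v W + fun i => v i • wavg 1 W‖ := by rw [← this]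
    _ ≤ _ := norm_add_le_of_le le_rfl (norm_smul_const_le _ _)

lemma IsIterates.norm_step_le (hxy : IsIterates f g R C γ lam x y)
    (hprob : ProblemAssumption f g μf Lf Lg) (hmix : MixingAssumption R C)
    (hupd : UpdateRules u v γ lam a b θ) {k : ℕ} {z : E n}
    (hz : z ∈ argminSet (regularized f g (lam k))) :
    ‖(fun i => γ k i • y k i : Fin m → E n)‖ ≤
      maxStep γ 0 * (1 + ‖v‖ * (Lg + lam 0 * Lf)) * powerDecay a k *
        (‖wavg u (x k) - z‖ + ‖xDeviation u (x k)‖ + ‖yDeviation v (y k)‖) := by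
  have hL : 0 ≤ Lg + lam 0 * Lf :=
    add_nonneg hprob.Lg_pos.le (mul_nonneg hupd.lam_pos.le hprob.Lf_pos.le)
  have h1 := hxy.norm_wavg_y_le hprob hmix hupd hz
  have h2 := norm_le_yDeviation_add (v := v) (y k)
  have h3 := mul_le_mul_of_nonneg_left h1 (norm_nonneg v)
  have h4 : ‖y k‖ ≤ (1 + ‖v‖ * (Lg + lam 0 * Lf)) *
      (‖wavg u (x k) - z‖ + ‖xDeviation u (x k)‖ + ‖yDeviation v (y k)‖) := by
    have : 0 ≤ ‖v‖ * (Lg + lam 0 * Lf) * ‖yDeviation v (y k)‖ := by positivity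
    have := norm_nonneg (wavg u (x k) - z)
    have := norm_nonneg (xDeviation u (x k))
    linarith
  have h5 := hupd.maxStep_pos
  have h6 := powerDecay_pos a k
  refine (hupd.norm_step_smul_le k (y k)).trans ?_
  have := mul_le_mul_of_nonneg_left h4 (mul_pos h5 h6).le
  linarith

/-- `R` fixes consensus vectors, so the movement sees only the deviation and the step. -/
lemma IsIterates.norm_x_succ_sub_le (hxy : IsIterates f g R C γ lam x y)
    (hmix : MixingAssumption R C) {c : ℝ} (hc : ∀ W : Fin m → E n, ‖R • W‖ ≤ c * ‖W‖) (k : ℕ) :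
    ‖x (k + 1) - x k‖ ≤ (c + 1) * ‖xDeviation u (x k)‖
      + c * ‖(fun i => γ k i • y k i : Fin m → E n)‖ := by
  have h1 : x k = xDeviation u (x k) + fun _ => wavg u (x k) := by
    ext1 i
    simp [xDeviation]
  have h2 : R • x k = R • xDeviation u (x k) + fun _ => wavg u (x k) := by
    conv_lhs => rw [h1]
    rw [smul_add, smul_const_of_rowSum hmix.R_row]
  have h3 : x (k + 1) - x k = R • xDeviation u (x k) - xDeviation u (x k)
      - R • fun i => γ k i • y k i := by
    rw [hxy.x_succ_eq, smul_sub, h2]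
    nth_rw 3 [h1]
    abel
  rw [h3, add_mul, one_mul]
  exact norm_sub_le_of_le (norm_sub_le_of_le (hc _) le_rfl) (hc _)

/-- The change of the stacked gradients along one iteration. -/
lemma norm_stackedGradient_increment_le (hprob : ProblemAssumption f g μf Lf Lg)
    (hupd : UpdateRules u v γ lam a b θ) {k : ℕ} {z : E n} {M : ℝ}
    (hM : ∀ i, ‖gradient (f i) z‖ ≤ M) (hM0 : 0 ≤ M) :
    ‖stackedGradient f g (lam (k + 1)) (x (k + 1)) - stackedGradient f g (lam k) (x k)‖ ≤
      (Lg + lam 0 * Lf) * ‖x (k + 1) - x k‖ + lam 0 * (M + Lf) * powerDecay 1 k *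
        (1 + ‖wavg u (x k) - z‖ + ‖xDeviation u (x k)‖) := by
  have hLf := hprob.Lf_pos
  set e := ‖wavg u (x k) - z‖ with he
  set d := ‖xDeviation u (x k)‖ with hd
  have hp := powerDecay_pos 1 k
  -- The iterates are not yet known to be bounded, so their gradients are compared with those at
  -- `z`; hence the factor `1 + e + d`.
  have h1 : ∀ i, ‖gradient (f i) (x k i)‖ ≤ M + Lf * (d + e) := fun i => by
    have h1 := (hprob.f_smooth i).2 (x k i) z
    have h2 := norm_le_norm_add_norm_sub' (gradient (f i) (x k i)) (gradient (f i) z)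
    have h3 : ‖x k i - z‖ ≤ d + e :=
      (norm_le_pi_norm (x k - fun _ => z) i).trans (norm_sub_const_le _ _)
    have h4 := mul_le_mul_of_nonneg_left h3 hLf.le
    linarith [hM i]
  have h2 := norm_stackedGradient_sub_param (f := f) (g := g) (lam (k + 1)) (lam k) (x k)
    (by positivity) h1
  have h3 := hprob.norm_stackedGradient_sub_le (hupd.lam_pos' (k + 1)).le (hupd.lam_le (k + 1))
    (x (k + 1)) (x k)
  have h4 := norm_sub_le_norm_sub_add_norm_sub (stackedGradient f g (lam (k + 1)) (x (k + 1)))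
    (stackedGradient f g (lam (k + 1)) (x k)) (stackedGradient f g (lam k) (x k))
  have h5 : |lam (k + 1) - lam k| ≤ lam 0 * powerDecay 1 k :=
    (hupd.abs_lam_sub_le k).trans (mul_le_mul_of_nonneg_right (hupd.lam_le k) hp.le)
  have h6 : M + Lf * (d + e) ≤ (M + Lf) * (1 + e + d) := by
    have : 0 ≤ M * (e + d) := by positivity
    linarith
  have h7 := mul_le_mul h5 h6 (by positivity) (mul_nonneg hupd.lam_pos.le hp.le)
  linarith

/-- One iteration contracts the distance of the average to the regularized minimizer. -/
lemma IsIterates.eventually_norm_wavg_sub_le (hxy : IsIterates f g R C γ lam x y)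
    (hprob : ProblemAssumption f g μf Lf Lg) (hmix : MixingAssumption R C)
    (hu : IsLeftEigenvector R u) (hupd : UpdateRules u v γ lam a b θ) {z : ℕ → E n}
    (hz : ∀ k, z k ∈ argminSet (regularized f g (lam k))) :
    ∀ᶠ k in atTop, ‖wavg u (x (k + 1)) - z k‖ ≤
      (1 - θ * maxStep γ 0 * lam 0 * μf / 2 * powerDecay (a + b) k) * ‖wavg u (x k) - z k‖
        + maxStep γ 0 * (1 + ‖v‖ * (Lg + lam 0 * Lf)) * powerDecay a k *
          (‖xDeviation u (x k)‖ + ‖yDeviation v (y k)‖) := by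
  have hm : (0 : ℝ) < m := by exact_mod_cast hmix.pos
  have hL : 0 ≤ Lg + lam 0 * Lf :=
    add_nonneg hprob.Lg_pos.le (mul_nonneg hupd.lam_pos.le hprob.Lf_pos.le)
  have hΓ := hupd.maxStep_pos
  have hl := hupd.lam_pos
  have hμ := hprob.μf_pos
  have hθ := hupd.θ_pos
  -- The two conditions for a contracting gradient step: step size times squared Lipschitz constant
  -- below the modulus, which needs `b < a`, and step size times modulus at most one.
  filter_upwards [eventually_mul_powerDecay_le (p := a - b) (by linarith [hupd.b_lt_a])
      (maxStep γ 0 * ‖v‖ * (Lg + lam 0 * Lf) ^ 2) (mul_pos hl hμ),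
    eventually_mul_powerDecay_le (p := a + b) (by linarith [hupd.b_lt_a, hupd.b_pos])
      (maxStep γ 0 * ‖v‖ * (lam 0 * μf)) one_pos] with k hk1 hk2
  set L := Lg + lam 0 * Lf with hLdef
  set α := effStep u v γ k with hα
  have hpa := powerDecay_pos a k
  have hpb := powerDecay_pos b k
  have hab : powerDecay a k * powerDecay b k = powerDecay (a + b) k := powerDecay_mul _ _ _
  have hamb : powerDecay (a - b) k * powerDecay b k = powerDecay a k := by
    rw [powerDecay_mul, sub_add_cancel]
  have hα0 : θ * maxStep γ 0 * powerDecay a k ≤ α := hupd.effStep_ge' k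
  have hαpos : 0 < α := lt_of_lt_of_le (by positivity) hα0
  have hα1 : α ≤ maxStep γ 0 * powerDecay a k * ‖v‖ := hupd.effStep_le hmix.pos hu k
  have hlam := hupd.lam_eq_powerDecay k
  have hlk := hupd.lam_pos' k
  set q := fun w : E n => wavg 1 (stackedGradient f g (lam k) fun _ => w) with hq
  -- `q` is `1 / m` times the gradient of the global objective, so the step on that objective is `α
  -- / m`.
  have hstep : ‖wavg u (x k) - α • q (wavg u (x k)) - z k‖ ≤
      (1 - α * (lam k * μf) / 2) * ‖wavg u (x k) - z k‖ := by
    have h1 : α / m * (m * L) ^ 2 ≤ lam k * (m * μf) := by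
      rw [show α / m * (m * L) ^ 2 = m * (α * L ^ 2) by field_simp,
        show lam k * (m * μf) = m * (lam k * μf) by ring]
      refine mul_le_mul_of_nonneg_left ?_ hm.le
      have i1 := mul_le_mul_of_nonneg_right hα1 (sq_nonneg L)
      have i2 := mul_le_mul_of_nonneg_right hk1 hpb.le
      rw [hlam]
      rw [← hamb] at i1
      linarith
    have h2 : α / m * (lam k * (m * μf)) = α * (lam k * μf) := by field_simp
    have h3 : α * (lam k * μf) ≤ 1 := by
      have i1 := mul_le_mul_of_nonneg_right hα1 (mul_pos hlk hμ).le
      rw [hlam] at i1 ⊢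
      rw [← hab] at hk2
      linarith
    have := (hprob.regularized_strong hlk.le).norm_gradient_step_le
      (hprob.regularized_smooth hlk.le (hupd.lam_le k)) (by positivity) h1 (by rw [h2]; exact h3)
      (gradient_eq_zero_of_mem_argminSet (hz k)) (wavg u (x k))
    rw [h2] at this
    rw [hq]
    simp only
    rw [hprob.wavg_stackedGradient_const, smul_smul, mul_one_div]
    exact this
  have hcon : (1 - α * (lam k * μf) / 2) * ‖wavg u (x k) - z k‖ ≤
      (1 - θ * maxStep γ 0 * lam 0 * μf / 2 * powerDecay (a + b) k) * ‖wavg u (x k) - z k‖ := by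
    refine mul_le_mul_of_nonneg_right ?_ (norm_nonneg _)
    have := mul_le_mul_of_nonneg_right hα0 (mul_pos hlk hμ).le
    rw [← hab]
    rw [hlam] at this ⊢
    linarith
  have hgrad : ‖α • (q (wavg u (x k)) - wavg 1 (y k))‖ ≤
      maxStep γ 0 * powerDecay a k * ‖v‖ * (L * ‖xDeviation u (x k)‖) := by
    rw [norm_smul, Real.norm_of_nonneg hαpos.le]
    refine mul_le_mul hα1 ?_ (norm_nonneg _) (by positivity)
    rw [norm_sub_rev, hxy.wavg_y hmix, hq, ← wavg_sub]
    exact (norm_wavg_one_le hmix.pos _).trans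
      (hprob.norm_stackedGradient_sub_le hlk.le (hupd.lam_le k) _ _)
  have htrack : ‖wavg u fun i => γ k i • yDeviation v (y k) i‖ ≤
      maxStep γ 0 * powerDecay a k * ‖yDeviation v (y k)‖ :=
    (norm_wavg_le hmix.pos hu.nonneg hu.sum_eq _).trans (hupd.norm_step_smul_le k _)
  -- Replacing `y k` by `v` times its mean turns the averaged step into exactly `effStep` times that
  -- mean; the deviation is an error term.
  have hsplit : (wavg u fun i => γ k i • y k i)
      = (wavg u fun i => γ k i • yDeviation v (y k) i) + α • wavg 1 (y k) := by
    have h1 : (fun i => γ k i • y k i) = (fun i => γ k i • yDeviation v (y k) i)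
        + fun i => (γ k i * v i) • wavg 1 (y k) := by
      ext1 i
      simp [yDeviation, smul_sub, smul_smul]
    rw [h1, wavg_add]
    congr 1
    generalize wavg 1 (y k) = p
    simp only [wavg, hα, effStep, smul_smul, ← Finset.sum_smul, mul_assoc]
  have hdec : wavg u (x (k + 1)) - z k = (wavg u (x k) - α • q (wavg u (x k)) - z k)
      + α • (q (wavg u (x k)) - wavg 1 (y k))
      - wavg u fun i => γ k i • yDeviation v (y k) i := by
    rw [hxy.wavg_x_succ hu, hsplit, smul_sub]
    abel
  rw [hdec]
  refine (norm_sub_le_of_le (norm_add_le_of_le (hstep.trans hcon) hgrad) htrack).trans ?_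
  have h1 : 0 ≤ maxStep γ 0 * powerDecay a k * ‖xDeviation u (x k)‖ := by positivity
  have h2 : 0 ≤ maxStep γ 0 * powerDecay a k * ‖v‖ * L * ‖yDeviation v (y k)‖ := by positivity
  linarith

/-- All three errors of the method decay like `1 / k ^ (1 - a - b)`. -/
lemma IsIterates.exists_rate (hxy : IsIterates f g R C γ lam x y)
    (hprob : ProblemAssumption f g μf Lf Lg) (hmix : MixingAssumption R C)
    (hu : IsLeftEigenvector R u) (hv : IsRightEigenvector C v)
    (hupd : UpdateRules u v γ lam a b θ) {z : ℕ → E n}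
    (hz : ∀ k, z k ∈ argminSet (regularized f g (lam k)))
    {M : ℝ} (hM0 : 0 ≤ M) (hM : ∀ k i, ‖gradient (f i) (z k)‖ ≤ M)
    {cz : ℝ} (hcz0 : 0 ≤ cz) (hcz : ∀ k, ‖z k - z (k + 1)‖ ≤ cz * powerDecay 1 k) :
    ∃ B, 0 < B ∧ ∀ᶠ k in atTop, ‖wavg u (x k) - z k‖ ≤ B * powerDecay (1 - a - b) k ∧
      ‖xDeviation u (x k)‖ ≤ B * powerDecay (1 - a - b) k ∧
      ‖yDeviation v (y k)‖ ≤ B * powerDecay (1 - a - b) k := by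
  obtain ⟨NR, σR, cR, hσR0, hσR1, hcR0, hRlow, hRup, hRc⟩ :=
    (hmix.hasSmallPowers_R hu).exists_adapted_norm (E n)
  obtain ⟨NC, σC, cC, hσC0, hσC1, hcC0, hClow, hCup, hCc⟩ :=
    (hmix.hasSmallPowers_C hv).exists_adapted_norm (E n)
  obtain ⟨cB, hcB0, hcB⟩ := exists_norm_matrix_smul_le (V := E n) R
  have hLg := hprob.Lg_pos
  have hLf := hprob.Lf_pos
  have hμ := hprob.μf_pos
  have hΓ := hupd.maxStep_pos
  have hl := hupd.lam_pos
  have hθ := hupd.θ_pos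
  set L := Lg + lam 0 * Lf with hLdef
  have hL : 0 ≤ L := by positivity
  set K₁ := maxStep γ 0 * (1 + ‖v‖ * L) with hK₁
  have hK₁0 : 0 ≤ K₁ := by positivity
  set K₂ := cC * (1 + ‖v‖) with hK₂
  have hK₂0 : 0 ≤ K₂ := by positivity
  set e := fun k => ‖wavg u (x k) - z k‖ with he
  set d := fun k => NR (xDeviation u (x k)) with hd
  set h := fun k => NC (yDeviation v (y k)) with hh
  have he0 : ∀ k, 0 ≤ e k := fun k => norm_nonneg _
  have hd0 : ∀ k, 0 ≤ d k := fun k => apply_nonneg _ _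
  have hh0 : ∀ k, 0 ≤ h k := fun k => apply_nonneg _ _
  -- The sum of all constants in the three recursions, so that each is at most `c`.
  set c := K₁ + cz + cR * K₁ + K₂ * L * (cB + 1) + K₂ * L * cB * K₁ + K₂ * lam 0 * (M + Lf)
    with hc
  have t1 : 0 ≤ cR * K₁ := by positivity
  have t2 : 0 ≤ K₂ * L * (cB + 1) := by positivity
  have t3 : 0 ≤ K₂ * L * cB * K₁ := by positivity
  have t4 : 0 ≤ K₂ * lam 0 * (M + Lf) := by positivity
  have hstep : ∀ k, ‖(fun i => γ k i • y k i : Fin m → E n)‖ ≤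
      K₁ * (powerDecay a k * (e k + d k + h k)) := fun k => by
    refine (hxy.norm_step_le hprob hmix hupd (hz k)).trans ?_
    rw [mul_assoc]
    have := powerDecay_pos a k
    have h1 := hRlow (xDeviation u (x k))
    have h2 := hClow (yDeviation v (y k))
    gcongr
  obtain ⟨B, hB, hBk⟩ := consensus_recursion_rate (e := e) (d := d) (h := h) (σ := max σR σC)
    (c₁ := θ * maxStep γ 0 * lam 0 * μf / 2) (c := c) hupd.b_pos hupd.b_lt_a hupd.add_lt_one
    (by positivity) (by positivity) (le_max_of_le_left hσR0) (max_lt hσR1 hσC1) he0 hd0 hh0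
    (by
      filter_upwards [hxy.eventually_norm_wavg_sub_le hprob hmix hu hupd hz] with k hk
      have h1 := hRlow (xDeviation u (x k))
      have h2 := hClow (yDeviation v (y k))
      have hpa := powerDecay_pos a k
      have h3 : K₁ * powerDecay a k * (‖xDeviation u (x k)‖ + ‖yDeviation v (y k)‖) ≤
          c * powerDecay a k * (d k + h k) := by
        refine mul_le_mul (mul_le_mul_of_nonneg_right (by linarith) hpa.le) (add_le_add h1 h2)
          (by positivity) (by positivity)
      have h4 : cz * powerDecay 1 k ≤ c * powerDecay 1 k :=
        mul_le_mul_of_nonneg_right (by linarith) (powerDecay_pos 1 k).le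
      have h5 := norm_sub_le_norm_sub_add_norm_sub (wavg u (x (k + 1))) (z k) (z (k + 1))
      have h6 := hcz k
      simp only [he] at hk ⊢
      linarith)
    (by
      refine Eventually.of_forall fun k => ?_
      have h1 : d (k + 1) ≤ σR * (d k + NR fun i => γ k i • y k i) := by
        simp only [hd]
        rw [hxy.xDeviation_succ hmix hu]
        exact (hRc _).trans (mul_le_mul_of_nonneg_left (map_sub_le_add _ _ _) hσR0)
      have h2 : (NR fun i => γ k i • y k i) ≤ cR * K₁ * (powerDecay a k * (e k + d k + h k)) := by
        rw [mul_assoc]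
        exact (hRup _).trans (mul_le_mul_of_nonneg_left (hstep k) hcR0)
      have h3 : σR * (NR fun i => γ k i • y k i) ≤ NR fun i => γ k i • y k i :=
        mul_le_of_le_one_left (apply_nonneg _ _) hσR1.le
      have h4 : σR * d k ≤ max σR σC * d k :=
        mul_le_mul_of_nonneg_right (le_max_left _ _) (hd0 k)
      have h5 : cR * K₁ * (powerDecay a k * (e k + d k + h k)) ≤
          c * (powerDecay a k * (e k + d k + h k)) :=
        mul_le_mul_of_nonneg_right (by linarith) (mul_nonneg (powerDecay_pos a k).le
          (add_nonneg (add_nonneg (he0 k) (hd0 k)) (hh0 k)))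
      linarith)
    (by
      refine Eventually.of_forall fun k => ?_
      set S := powerDecay a k * (e k + d k + h k) with hS
      have hS0 : 0 ≤ S := mul_nonneg (powerDecay_pos a k).le
          (add_nonneg (add_nonneg (he0 k) (hd0 k)) (hh0 k))
      set T := powerDecay 1 k * (1 + e k + d k) with hT
      have hT0 : 0 ≤ T := mul_nonneg (powerDecay_pos 1 k).le
          (add_nonneg (add_nonneg zero_le_one (he0 k)) (hd0 k))
      set Δ := stackedGradient f g (lam (k + 1)) (x (k + 1)) - stackedGradient f g (lam k) (x k)
        with hΔ
      have h1 : h (k + 1) ≤ σC * h k + K₂ * ‖Δ‖ := by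
        simp only [hh]
        rw [hxy.yDeviation_succ hmix hv, hK₂, mul_assoc]
        exact (map_add_le_add _ _ _).trans (add_le_add (hCc _)
          ((hCup _).trans (mul_le_mul_of_nonneg_left (norm_yDeviation_le hmix.pos _) hcC0)))
      have hdk := hRlow (xDeviation u (x k))
      have h2 : ‖x (k + 1) - x k‖ ≤ (cB + 1) * d k + cB * (K₁ * S) :=
        (hxy.norm_x_succ_sub_le hmix hcB k).trans (add_le_add
          (mul_le_mul_of_nonneg_left hdk (by positivity))
          (mul_le_mul_of_nonneg_left (hstep k) hcB0))
      have h3 : ‖Δ‖ ≤ L * ((cB + 1) * d k + cB * (K₁ * S)) + lam 0 * (M + Lf) * T := by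
        refine (norm_stackedGradient_increment_le (u := u) hprob hupd (hM k) hM0).trans
          (add_le_add (mul_le_mul_of_nonneg_left h2 hL) ?_)
        rw [mul_assoc (lam 0 * (M + Lf))]
        refine mul_le_mul_of_nonneg_left (mul_le_mul_of_nonneg_left ?_ (powerDecay_pos 1 k).le)
          (by positivity)
        linarith
      have h4 := mul_le_mul_of_nonneg_left h3 hK₂0
      have h5 : K₂ * L * (cB + 1) * d k ≤ c * d k :=
        mul_le_mul_of_nonneg_right (by linarith) (hd0 k)
      have h6 : K₂ * L * cB * K₁ * S ≤ c * S := mul_le_mul_of_nonneg_right (by linarith) hS0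
      have h7 : K₂ * lam 0 * (M + Lf) * T ≤ c * T :=
        mul_le_mul_of_nonneg_right (by linarith) hT0
      have h8 : σC * h k ≤ max σR σC * h k :=
        mul_le_mul_of_nonneg_right (le_max_right _ _) (hh0 k)
      rw [mul_assoc c, mul_assoc c]
      linarith)
  exact ⟨B, hB, hBk.mono fun k hk => ⟨hk.1, (hRlow _).trans hk.2.1, (hClow _).trans hk.2.2⟩⟩

end Rates

/-! ### From decay rates to the stated bounds. -/

section Conclusion

variable {m n : ℕ} {f g : Fin m → E n → ℝ} {μf Lf Lg : ℝ} {R C : Matrix (Fin m) (Fin m) ℝ}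
  {u v : Fin m → ℝ} {γ : ℕ → Fin m → ℝ} {lam : ℕ → ℝ} {a b θ : ℝ} {x y : ℕ → Fin m → E n}

/-- Both signs are needed: `2 - 2 * a - 3 * b` may be negative, and then `k + 1 ≤ 2 * k` costs a
factor `2 ^ (-p)`. -/
lemma exists_powerDecay_le (p : ℝ) :
    ∃ c, 0 < c ∧ ∀ k : ℕ, 1 ≤ k → powerDecay p k ≤ c * (1 / (k : ℝ) ^ p) := by
  rcases le_total 0 p with hp | hp
  · refine ⟨1, one_pos, fun k hk => ?_⟩
    have hk' : (0 : ℝ) < k := by exact_mod_cast hk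
    rw [one_mul, one_div, ← Real.rpow_neg hk'.le]
    exact Real.rpow_le_rpow_of_nonpos hk' (by linarith) (by linarith)
  · refine ⟨2 ^ (-p), by positivity, fun k hk => ?_⟩
    have hk' : (1 : ℝ) ≤ k := by exact_mod_cast hk
    rw [one_div, ← Real.rpow_neg (by linarith), ← Real.mul_rpow (by norm_num) (by linarith)]
    exact Real.rpow_le_rpow (by positivity) (by linarith) (by linarith)

lemma powerDecay_succ_le_of_nonneg {p : ℝ} (hp : 0 ≤ p) {k : ℕ} (hk : 1 ≤ k) :
    powerDecay p (k + 1) ≤ 1 / (k : ℝ) ^ p := by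
  have hk' : (0 : ℝ) < k := by exact_mod_cast hk
  rw [one_div, ← Real.rpow_neg hk'.le]
  exact Real.rpow_le_rpow_of_nonpos hk' (by push_cast; linarith) (by linarith)

/-- Expanding each column in the standard basis bounds `N` by a multiple of the sup norm, in which
the rates are proved. -/
lemma exists_inducedNorm_le (N : Seminorm ℝ (Fin m → ℝ)) :
    ∃ c, 0 ≤ c ∧ ∀ W : Fin m → E n, inducedNorm N W ≤ c * ‖W‖ := by
  set c := ∑ i, N (Pi.single i 1) with hc
  have hc0 : 0 ≤ c := Finset.sum_nonneg fun i _ => apply_nonneg _ _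
  refine ⟨√n * c, by positivity, fun W => ?_⟩
  have hcol : ∀ j, N (fun i => W i j) ≤ c * ‖W‖ := fun j => by
    have h1 : (fun i => W i j) = ∑ i, W i j • (Pi.single i 1 : Fin m → ℝ) := by
      ext l
      simp [Finset.sum_apply, Pi.single_apply]
    rw [h1, hc, Finset.sum_mul]
    refine (Finset.le_sum_of_subadditive N (map_zero N).le (map_add_le_add N) _ _).trans
      (Finset.sum_le_sum fun i _ => ?_)
    rw [map_smul_eq_mul, mul_comm]
    exact mul_le_mul_of_nonneg_left ((PiLp.norm_apply_le (W i) j).trans (norm_le_pi_norm W i))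
      (apply_nonneg _ _)
  rw [inducedNorm, mul_assoc]
  have h2 : ∑ j, N (fun i => W i j) ^ 2 ≤ n * (c * ‖W‖) ^ 2 := by
    calc _ ≤ ∑ _j : Fin n, (c * ‖W‖) ^ 2 :=
          Finset.sum_le_sum fun j _ => pow_le_pow_left₀ (apply_nonneg _ _) (hcol j) 2
      _ = _ := by simp
  refine (Real.sqrt_le_sqrt h2).trans ?_
  rw [Real.sqrt_mul (Nat.cast_nonneg n), Real.sqrt_sq (by positivity)]

lemma inducedNorm_isBigO (N : Seminorm ℝ (Fin m → ℝ)) {W : ℕ → Fin m → E n} {p B : ℝ}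
    (hp : 0 ≤ p) (hB : 0 ≤ B) (hW : ∀ᶠ k in atTop, ‖W k‖ ≤ B * powerDecay p k) :
    (fun k : ℕ => inducedNorm N (W (k + 1))) =O[atTop] fun k : ℕ => 1 / (k : ℝ) ^ p := by
  obtain ⟨c, hc0, hc⟩ := exists_inducedNorm_le (n := n) N
  refine IsBigO.of_bound (c * B) ?_
  filter_upwards [(tendsto_add_atTop_nat 1).eventually hW, eventually_ge_atTop 1] with k h1 h2
  rw [Real.norm_of_nonneg (show 0 ≤ inducedNorm N _ from Real.sqrt_nonneg _), Real.norm_of_nonneg (by positivity), mul_assoc]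
  refine (hc _).trans (mul_le_mul_of_nonneg_left (h1.trans ?_) hc0)
  exact mul_le_mul_of_nonneg_left (powerDecay_succ_le_of_nonneg hp h2) hB

/-- The regularized objective at a point close to its minimizer, compared with a point `w`. -/
lemma ProblemAssumption.regularized_le (h : ProblemAssumption f g μf Lf Lg) {l l₀ : ℝ}
    (hl : 0 ≤ l) (hl₀ : l ≤ l₀) {z : E n} (hz : z ∈ argminSet (regularized f g l)) {p : E n}
    {δ : ℝ} (hp : ‖p - z‖ ≤ δ) (w : E n) :
    regularized f g l p ≤ regularized f g l w + m * (Lg + l₀ * Lf) / 2 * δ ^ 2 := by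
  have h1 := (h.regularized_smooth hl hl₀).upper_bound z p
  rw [gradient_eq_zero_of_mem_argminSet hz, inner_zero_left, add_zero] at h1
  have h2 := hz w
  have h3 : 0 ≤ m * (Lg + l₀ * Lf) / 2 := by
    have := h.Lg_pos
    have := h.Lf_pos
    have := hl.trans hl₀
    positivity
  have h4 := mul_le_mul_of_nonneg_left (pow_le_pow_left₀ (norm_nonneg _) hp 2) h3
  linarith

end Conclusion

end IRPP

end

theorem theorem1 {m n : ℕ} (f g : Fin m → IRPP.E n → ℝ) (μf Lf Lg : ℝ)
    (R C : Matrix (Fin m) (Fin m) ℝ) (u v : Fin m → ℝ)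
    (γ : ℕ → Fin m → ℝ) (lam : ℕ → ℝ) (a b θ : ℝ)
    (x y : ℕ → Fin m → IRPP.E n)
    (hprob : IRPP.ProblemAssumption f g μf Lf Lg)
    (hmix : IRPP.MixingAssumption R C)
    (hu : IRPP.IsLeftEigenvector R u) (hv : IRPP.IsRightEigenvector C v)
    (hupd : IRPP.UpdateRules u v γ lam a b θ)
    (hxy : IRPP.IsIterates f g R C γ lam x y) :
    ∃ xstar : IRPP.E n,
      -- `xstar` is the unique solution of the bilevel problem
      (∀ z, IRPP.IsBilevelSolution (IRPP.total f) (IRPP.total g) z ↔ z = xstar) ∧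
      -- (a) convergence of the weighted average
      Tendsto (fun k => IRPP.wavg u (x k)) atTop (𝓝 xstar) ∧
      -- (a) the norms attached to `R` and `C` exist
      (∃ NR NC : Seminorm ℝ (Fin m → ℝ),
        IRPP.IsContractionNorm NR (Matrix.of fun i j => R i j - u j / (m : ℝ)) ∧
        IRPP.IsContractionNorm NC (Matrix.of fun i j => C i j - v i / (m : ℝ))) ∧
      -- (a) consensus violation, in these and in all other norms
      (∀ N : Seminorm ℝ (Fin m → ℝ), (∀ w, N w = 0 → w = 0) →
        (fun k : ℕ => IRPP.inducedNorm N
            (fun i => x (k + 1) i - IRPP.wavg u (x (k + 1))))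
          =O[atTop] (fun k : ℕ => 1 / (k : ℝ) ^ (1 - a - b)) ∧
        (fun k : ℕ => IRPP.inducedNorm N
            (fun i => y (k + 1) i - v i • IRPP.wavg 1 (y (k + 1))))
          =O[atTop] (fun k : ℕ => 1 / (k : ℝ) ^ (1 - a - b))) ∧
      -- (b) suboptimality
      (∃ Q₁ : ℝ, 0 < Q₁ ∧ ∀ᶠ k : ℕ in atTop,
        IRPP.total f (IRPP.wavg u (x k)) - IRPP.total f xstar
          ≤ Q₁ * (Lg + lam 0 * Lf) / 2 * (1 / (k : ℝ) ^ (2 - 2 * a - 3 * b))) ∧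
      -- (c) infeasibility
      (∃ Q₂ Q₃ : ℝ, 0 < Q₂ ∧ 0 < Q₃ ∧ ∀ᶠ k : ℕ in atTop,
        IRPP.total g (IRPP.wavg u (x k)) - IRPP.total g xstar
          ≤ Q₂ * (Lg + lam 0 * Lf) / 2 * (1 / (k : ℝ) ^ (2 - 2 * a - 2 * b))
            + lam 0 * Q₃ / (k : ℝ) ^ b) := by
  open IRPP in
  have hm := hmix.pos
  have hm' : (0 : ℝ) < m := by exact_mod_cast hm
  have hF := hprob.total_f_strong
  have hμ : 0 < m * μf := mul_pos hm' hprob.μf_pos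
  have hl := hupd.lam_pos
  have hL : 0 < Lg + lam 0 * Lf := by
    have := hprob.Lg_pos
    have := hprob.Lf_pos
    positivity
  have hab := hupd.add_lt_one
  obtain ⟨xstar, hx⟩ := hF.existsUnique_isBilevelSolution hμ hprob.total_g_convex
    hprob.argmin_nonempty
  obtain ⟨z, hz, hzlim, ⟨M, hM0, hM⟩, cz, hcz0, hcz⟩ := exists_regularized_path hprob hm hupd hx
  obtain ⟨B, hB, hrate⟩ := hxy.exists_rate hprob hmix hu hv hupd hz hM0 hM hcz0 hcz
  have hopt : xstar ∈ argminSet (total g) := ((hx xstar).2 rfl).1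
  have hlim : Tendsto (fun k => wavg u (x k)) atTop (𝓝 xstar) := by
    have h1 : Tendsto (fun k => wavg u (x k) - z k) atTop (𝓝 0) := by
      refine squeeze_zero_norm' (hrate.mono fun k hk => hk.1) ?_
      simpa using (tendsto_powerDecay (p := 1 - a - b) (by linarith)).const_mul B
    simpa using h1.add hzlim
  have hgap : ∀ᶠ k in atTop, total g (wavg u (x k)) + lam k * total f (wavg u (x k)) ≤
      total g xstar + lam k * total f xstar + m * (Lg + lam 0 * Lf) / 2 * B ^ 2 *
        powerDecay (2 - 2 * a - 2 * b) k := by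
    filter_upwards [hrate] with k hk
    have h1 := hprob.regularized_le (hupd.lam_pos' k).le (hupd.lam_le k) (hz k) hk.1 xstar
    have h2 : powerDecay (1 - a - b) k ^ 2 = powerDecay (2 - 2 * a - 2 * b) k := by
      rw [sq, powerDecay_mul]; ring_nf
    rw [mul_pow, h2, ← mul_assoc] at h1
    exact h1
  refine ⟨xstar, hx, hlim, ?_, fun N _ => ⟨?_, ?_⟩, ?_, ?_⟩
  · obtain ⟨NR, hNR⟩ := (hmix.hasSmallPowers_R hu).exists_isContractionNorm
    obtain ⟨NC, hNC⟩ := (hmix.hasSmallPowers_C hv).exists_isContractionNorm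
    exact ⟨NR, NC, hNR, hNC⟩
  · exact inducedNorm_isBigO N (W := fun k => xDeviation u (x k)) (by linarith) hB.le
      (hrate.mono fun k hk => hk.2.1)
  · exact inducedNorm_isBigO N (W := fun k => yDeviation v (y k)) (by linarith) hB.le
      (hrate.mono fun k hk => hk.2.2)
  · obtain ⟨c, hc, hcp⟩ := exists_powerDecay_le (2 - 2 * a - 3 * b)
    -- The regularized gap is divided by `lam k`, which costs `1 / lam 0` and lowers the exponent by
    -- `b`; `c` passes from `k + 1` to `k`.
    refine ⟨m * B ^ 2 / lam 0 * c, by positivity, ?_⟩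
    filter_upwards [hgap, eventually_ge_atTop 1] with k hk hk1
    have h1 := hopt (wavg u (x k))
    have h2 : powerDecay b k * powerDecay (2 - 2 * a - 3 * b) k
        = powerDecay (2 - 2 * a - 2 * b) k := by
      rw [powerDecay_mul]; ring_nf
    have h3 : total f (wavg u (x k)) - total f xstar ≤
        m * B ^ 2 / lam 0 * (Lg + lam 0 * Lf) / 2 * powerDecay (2 - 2 * a - 3 * b) k := by
      refine le_of_mul_le_mul_left ?_ (hupd.lam_pos' k)
      have h4 : lam k * (m * B ^ 2 / lam 0 * (Lg + lam 0 * Lf) / 2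
          * powerDecay (2 - 2 * a - 3 * b) k)
          = m * (Lg + lam 0 * Lf) / 2 * B ^ 2 * powerDecay (2 - 2 * a - 2 * b) k := by
        rw [hupd.lam_eq_powerDecay k, ← h2]
        field_simp
      rw [h4]
      linarith
    refine h3.trans ?_
    have h5 := mul_le_mul_of_nonneg_left (hcp k hk1)
      (show 0 ≤ m * B ^ 2 / lam 0 * (Lg + lam 0 * Lf) / 2 by positivity)
    linarith
  · obtain ⟨c, hc, hcp⟩ := exists_powerDecay_le (2 - 2 * a - 2 * b)
    obtain ⟨c', hc', hcp'⟩ := exists_powerDecay_le b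
    refine ⟨m * B ^ 2 * c, c', by positivity, hc', ?_⟩
    -- Since the averages converge, `f xstar - f` is eventually at most `1` along them, so the
    -- regularization term costs at most `lam k`.
    have hcont : ∀ᶠ k in atTop, total f xstar - 1 ≤ total f (wavg u (x k)) :=
      ((hF.1.continuous.tendsto xstar).comp hlim).eventually_const_le (by linarith)
    filter_upwards [hgap, hcont, eventually_ge_atTop 1] with k hk hk2 hk1
    have h1 := mul_le_mul_of_nonneg_left hk2 (hupd.lam_pos' k).le
    have h2 : lam k ≤ lam 0 * c' / (k : ℝ) ^ b := by
      rw [hupd.lam_eq_powerDecay k, mul_div_assoc, div_eq_mul_one_div c']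
      exact mul_le_mul_of_nonneg_left (hcp' k hk1) hl.le
    have h3 := mul_le_mul_of_nonneg_left (hcp k hk1)
      (show 0 ≤ m * (Lg + lam 0 * Lf) / 2 * B ^ 2 by positivity)
    linarith
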